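/- **Setting.** Let $d\ge 1$, let $N\le N'$ be natural numbers, $\Delta N:=N'-N$, and let $k,T>0$, $\beta:=1/(kT)$. Consider non-interacting $d$-level systems, each with Hamiltonian $H=\sum_i E_i|i\rangle\langle i|$ ($E_i\in\mathbb R$ arbitrary), Gibbs state $\Gamma=e^{-\beta H}/Z$, $Z=\mathrm{Tr}\,e^{-\beta H}$. Put $E_{\max}=\max_iE_i$, $A_{\max}:=E_{\max}$, $A_{\rm Gibbs}:=-kT\ln Z$ and $\Delta A_{\max}:=A_{\max}-A_{\rm Gibbs}$. The input system $A$ consists of $N$ copies and the output system $B$ of $N'$ copies, with Gibbs states $\Gamma_A=\Gamma^{\otimes N}$, $\Gamma_B=\Gamma^{\otimes N'}$. Let $P_n$ be the projector on the totally symmetric subspace of $n$ copies and $d_n=\mathrm{Tr}\,P_n$. $\log$ is the logarithm to base $2$; a channel is a completely positive trace-preserving map. **Nonequilibrium cost.** For a channel $\mathcal M:A\to B$ and a projector $\Pi_A$, the cost is $$c(\mathcal M,\Pi_A)=\min\{\lambda\in\mathbb R:\ \mathcal M'(\Gamma_A)\le 2^{\lambda}\,\Gamma_B\},$$ where $\mathcal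 M'$ ranges over the completely positive trace non-increasing maps with $\mathcal M'(\Pi_A\rho\Pi_A)=\mathcal M(\Pi_A\rho\Pi_A)$ for all density operators $\rho$. **Tasks.** A task $\mathcal T$ is given by input states $\rho_x$, output observables $O_x\ge0$ ($x\in X$) and a projector $\Pi_A$. Its accuracy is $\mathcal F_{\mathcal T}(\mathcal M)=\inf_x\mathrm{Tr}[O_x\mathcal M(\rho_x)]$, its cost of accuracy is $c_{\mathcal T}(F)=\min\{c(\mathcal M,\Pi_A):\mathcal M\text{ a channel},\ \mathcal F_{\mathcal T}(\mathcal M)\ge F\}$, and its reverse entropy is $$\kappa_{\mathcal T}=-\log\max_{\mathcal R}\inf_x\mathrm{Tr}\big[\Gamma_A^{-1/2}\rho_x\Gamma_A^{-1/2}\,\mathcal R(\Gamma_B^{1/2}O_x\Gamma_B^{1/2})\big],$$ with $\mathcal R$ ranging over the channels from $B$ to $A$. Let $c_{\min}$ be the minimum of $c(\mathcal M,\Pi_A)$ over all channels $\mathcal M$, let $F_{\min}$ be the maximum of $\mathcal F_{\mathcal T}(\mathcal M)$ over the channels with $c(\mathcal M,\Pi_A)\le c_{\min}$, and let $F_{\max}$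 be the maximum of $\mathcal F_{\mathcal T}$ over all channels. Universal quantum cloning is the task with $\rho_\psi=\psi^{\otimes N}$, $O_\psi=\psi^{\otimes N'}$, $\psi$ ranging over all pure states of one system, and $\Pi_A=P_N$. Classical cloning is the task with $\rho_x=|x\rangle\langle x|^{\otimes N}$, $O_x=|x\rangle\langle x|^{\otimes N'}$, $x$ ranging over the energy eigenstates, and $\Pi_A$ the projector on the span of the $|x\rangle^{\otimes N}$. Denote their reverse entropies by $\kappa^{\rm Q}_{\rm clon}$ and $\kappa^{\rm C}_{\rm clon}$. An *optimal universal cloner* is a channel with $$\mathcal M_{\rm opt}(\psi^{\otimes N})=\frac{d_N}{d_{N'}}\,P_{N'}\big(\psi^{\otimes N}\otimes I^{\otimes\Delta N}\big)P_{N'}\qquad\text{for all pure states }\psi .$$ **Theorem.** The minimum defining $c(\mathcal M,P_N)$ is attained for every channel $\mathcal M$; the maxima defining the two reverse entropies, the minima and maxima defining $c_{\min}$, $F_{\min}$ and $F_{\max}$ for universal quantum cloning, and the minimum defining $c_{\rm clon}(F):=c_{\mathcal T}(F)$ for universal quantum cloning at every $F\in[F_{\min},F_{\max}]$ are attained; and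 the following hold. 1. An optimal universal cloner $\mathcal M_{\rm opt}$ exists. Every such channel has accuracy $d_N/d_{N'}$ in universal quantum cloning, and this is the largest accuracy of any channel: $F_{\max}=d_N/d_{N'}$. 2. Every optimal universal cloner has nonequilibrium cost $$c(\mathcal M_{\rm opt},P_N)=\frac{\Delta N\,\Delta A_{\max}}{kT\ln2}+\log F_{\max}.$$ 3. The reverse entropies of quantum and classical cloning coincide: $$\kappa^{\rm Q}_{\rm clon}=\kappa^{\rm C}_{\rm clon}=\frac{\Delta N\,\Delta A_{\max}}{kT\ln2}.$$ 4. For universal quantum cloning $F_{\min}=2^{c_{\min}-\kappa^{\rm Q}_{\rm clon}}$, and for every $F\in[F_{\min},F_{\max}]$ $$c_{\rm clon}(F)=\kappa^{\rm Q}_{\rm clon}+\log F=\frac{\Delta N\,\Delta A_{\max}}{kT\ln2}+\log F .$$ -/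

import Mathlib

namespace ThermoCloning

open Matrix
open scoped ComplexOrder

/-! ### Gibbs distributions -/

section Gibbs

variable {A : Type} [Fintype A]

/-- Partition function at inverse temperature `β` of a system with energy levels `ε`. -/
noncomputable def partitionFunction (β : ℝ) (ε : A → ℝ) : ℝ := ∑ a, Real.exp (-β * ε a)

/-- Gibbs distribution. -/
noncomputable def gibbsProb (β : ℝ) (ε : A → ℝ) (a : A) : ℝ :=
  Real.exp (-β * ε a) / partitionFunction β ε

/-- Free energy `- kT ln Z` of the Gibbs state. -/
noncomputable def gibbsFreeEnergy (kT : ℝ) (ε : A → ℝ) : ℝ :=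
  -kT * Real.log (partitionFunction (1 / kT) ε)

/-- `- kT ln Z` is the mean energy minus `kT` times the entropy of the Gibbs state. -/
theorem gibbsFreeEnergy_eq [Nonempty A] {kT : ℝ} (hkT : 0 < kT) (ε : A → ℝ) :
    gibbsFreeEnergy kT ε
      = ∑ a, gibbsProb (1 / kT) ε a * ε a
        - kT * (- ∑ a, gibbsProb (1 / kT) ε a * Real.log (gibbsProb (1 / kT) ε a)) := by
  have hZ : 0 < partitionFunction (1 / kT) ε :=
    Finset.sum_pos (fun a _ => Real.exp_pos _) Finset.univ_nonempty
  have h1 : ∑ a, gibbsProb (1 / kT) ε a = 1 := by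
    unfold gibbsProb
    rw [← Finset.sum_div]
    exact div_self hZ.ne'
  have h2 : ∀ a, kT * Real.log (gibbsProb (1 / kT) ε a)
      = -ε a - kT * Real.log (partitionFunction (1 / kT) ε) := by
    intro a
    unfold gibbsProb
    rw [Real.log_div (Real.exp_pos _).ne' hZ.ne', Real.log_exp]
    field_simp
  have h3 : kT * ∑ a, gibbsProb (1 / kT) ε a * Real.log (gibbsProb (1 / kT) ε a)
      = - ∑ a, gibbsProb (1 / kT) ε a * ε a
        - kT * Real.log (partitionFunction (1 / kT) ε) := by
    calc _ = ∑ a, gibbsProb (1 / kT) ε a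
              * (-ε a - kT * Real.log (partitionFunction (1 / kT) ε)) := by
            rw [Finset.mul_sum]
            refine Finset.sum_congr rfl fun a _ => ?_
            rw [← h2 a]; ring
      _ = _ := by
            simp only [mul_sub, Finset.sum_sub_distrib, ← Finset.sum_mul, h1]
            simp
  unfold gibbsFreeEnergy
  linarith

end Gibbs

/-! ### Quantum operations and channels between finite-dimensional systems

A system is given by a finite set of labels of an orthonormal basis; operators are matrices. -/

section Operations

variable {A B : Type} [Fintype A] [DecidableEq A] [Fintype B] [DecidableEq B]

/-- The action of `Φ ⊗ id` on operators of the system extended by a `k`-dimensional reference. -/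
def ampliation (Φ : Matrix A A ℂ →ₗ[ℂ] Matrix B B ℂ) (k : ℕ)
    (M : Matrix (A × Fin k) (A × Fin k) ℂ) : Matrix (B × Fin k) (B × Fin k) ℂ :=
  Matrix.of fun p q => Φ (Matrix.of fun a a' => M (a, p.2) (a', q.2)) p.1 q.1

/-- Complete positivity: `Φ ⊗ id` is positive for every finite-dimensional reference. -/
def IsCompletelyPositive (Φ : Matrix A A ℂ →ₗ[ℂ] Matrix B B ℂ) : Prop :=
  ∀ (k : ℕ) (M : Matrix (A × Fin k) (A × Fin k) ℂ),
    M.PosSemidef → (ampliation Φ k M).PosSemidef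

/-- Density operators. -/
def IsDensity (ρ : Matrix A A ℂ) : Prop := ρ.PosSemidef ∧ ρ.trace = 1

/-- Quantum operations: completely positive trace non-increasing maps. -/
def IsQuantumOperation (Φ : Matrix A A ℂ →ₗ[ℂ] Matrix B B ℂ) : Prop :=
  IsCompletelyPositive Φ ∧ ∀ ρ, IsDensity ρ → (Φ ρ).trace.re ≤ 1

/-- Quantum channels: completely positive trace-preserving maps. -/
def IsChannel (Φ : Matrix A A ℂ →ₗ[ℂ] Matrix B B ℂ) : Prop :=
  IsCompletelyPositive Φ ∧ ∀ ρ, (Φ ρ).trace = ρ.trace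

/-! ### Gibbs states -/

/-- The real power `Γ ^ s` of the Gibbs state `Γ` of the Hamiltonian `∑ a, ε a |a⟩⟨a|`. -/
noncomputable def gibbsPow (β : ℝ) (ε : A → ℝ) (s : ℝ) : Matrix A A ℂ :=
  Matrix.diagonal fun a => ((gibbsProb β ε a ^ s : ℝ) : ℂ)

/-- The Gibbs state `Γ`. -/
noncomputable def gibbs (β : ℝ) (ε : A → ℝ) : Matrix A A ℂ :=
  Matrix.diagonal fun a => ((gibbsProb β ε a : ℝ) : ℂ)

/-! ### Nonequilibrium cost of a channel

The input system has energy levels `εA`, the output system has energy levels `εB`, and the inputs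
lie in the support of the projector `P`. -/

/-- The numbers `l` for which some quantum operation `M'` acts as `M` on the support of `P` and
satisfies `M' Γ_A ≤ 2 ^ l Γ_B`. -/
def costExponents (β : ℝ) (εA : A → ℝ) (εB : B → ℝ) (P : Matrix A A ℂ)
    (M : Matrix A A ℂ →ₗ[ℂ] Matrix B B ℂ) : Set ℝ :=
  {l | ∃ M' : Matrix A A ℂ →ₗ[ℂ] Matrix B B ℂ, IsQuantumOperation M' ∧
    (∀ ρ, IsDensity ρ → M' (P * ρ * P) = M (P * ρ * P)) ∧
    (((2 : ℝ) ^ l) • gibbs β εB - M' (gibbs β εA)).PosSemidef}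

/-- The nonequilibrium cost (in clean qubits) of `M` on inputs in the support of `P`. -/
noncomputable def channelCost (β : ℝ) (εA : A → ℝ) (εB : B → ℝ) (P : Matrix A A ℂ)
    (M : Matrix A A ℂ →ₗ[ℂ] Matrix B B ℂ) : ℝ :=
  sInf (costExponents β εA εB P M)

end Operations

/-! ### Information processing tasks -/

/-- A task with input system `A` and output system `B` at inverse temperature `β`: input states and
output observables labelled by `X`, the energy levels of both systems, and the projector on the
input subspace. -/
structure Task (X A B : Type) where
  β : ℝ
  energyIn : A → ℝ
  energyOut : B → ℝ
  proj : Matrix A A ℂ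
  state : X → Matrix A A ℂ
  obs : X → Matrix B B ℂ

namespace Task

variable {X A B : Type} [Fintype A] [DecidableEq A] [Fintype B] [DecidableEq B]

/-- Nonequilibrium cost of a channel on the input subspace of the task. -/
noncomputable def cost (t : Task X A B) (M : Matrix A A ℂ →ₗ[ℂ] Matrix B B ℂ) : ℝ :=
  channelCost t.β t.energyIn t.energyOut t.proj M

/-- Worst-case accuracy of `M`. -/
noncomputable def accuracy (t : Task X A B) (M : Matrix A A ℂ →ₗ[ℂ] Matrix B B ℂ) : ℝ :=
  ⨅ x, (t.obs x * M (t.state x)).trace.re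

/-- The accuracies of all channels. -/
def accuracies (t : Task X A B) : Set ℝ :=
  {F | ∃ M, IsChannel M ∧ F = t.accuracy M}

/-- The costs of all channels with accuracy at least `F`. -/
def costsOfAccuracy (t : Task X A B) (F : ℝ) : Set ℝ :=
  {c | ∃ M, IsChannel M ∧ F ≤ t.accuracy M ∧ c = t.cost M}

/-- The nonequilibrium cost of accuracy `F` in the task. -/
noncomputable def costOfAccuracy (t : Task X A B) (F : ℝ) : ℝ := sInf (t.costsOfAccuracy F)

/-- The costs of all channels. -/
def costs (t : Task X A B) : Set ℝ := {c | ∃ M, IsChannel M ∧ c = t.cost M}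

/-- The smallest cost of a channel on the input subspace. -/
noncomputable def minCost (t : Task X A B) : ℝ := sInf t.costs

/-- The accuracies of the channels of smallest cost. -/
def accuraciesAtMinCost (t : Task X A B) : Set ℝ :=
  {F | ∃ M, IsChannel M ∧ t.cost M ≤ t.minCost ∧ F = t.accuracy M}

/-- `F_min`: the largest accuracy of a channel of smallest cost. -/
noncomputable def minAccuracy (t : Task X A B) : ℝ := sSup t.accuraciesAtMinCost

/-- Accuracy of a channel in the time-reversed task, with states `Γ_B^{1/2} O_x Γ_B^{1/2}` and
observables `Γ_A^{-1/2} ρ_x Γ_A^{-1/2}`. -/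
noncomputable def revAccuracy (t : Task X A B) (R : Matrix B B ℂ →ₗ[ℂ] Matrix A A ℂ) : ℝ :=
  ⨅ x, ((gibbsPow t.β t.energyIn (-(1 / 2)) * t.state x * gibbsPow t.β t.energyIn (-(1 / 2)))
    * R (gibbsPow t.β t.energyOut (1 / 2) * t.obs x * gibbsPow t.β t.energyOut (1 / 2))).trace.re

/-- The accuracies of all channels in the time-reversed task. -/
def revAccuracies (t : Task X A B) : Set ℝ :=
  {F | ∃ R, IsChannel R ∧ F = t.revAccuracy R}

/-- The maximum accuracy of the time-reversed task. -/
noncomputable def maxRevAccuracy (t : Task X A B) : ℝ := sSup t.revAccuracies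

/-- The reverse entropy of the task. -/
noncomputable def reverseEntropy (t : Task X A B) : ℝ := -Real.logb 2 t.maxRevAccuracy

end Task

/-! ### Cloning

`N` copies of a `d`-level system have the product basis labelled by `Fin N → Fin d`. -/

section Cloning

variable {d : ℕ}

/-- Labels of the product basis of `N` copies. -/
abbrev Copies (d N : ℕ) : Type := Fin N → Fin d

/-- Energy levels of `N` non-interacting copies. -/
def copiesEnergy (E : Fin d → ℝ) (N : ℕ) (i : Copies d N) : ℝ := ∑ k, E (i k)

/-- Unit vectors of a `d`-level system. -/
abbrev PureState (d : ℕ) : Type := {ψ : EuclideanSpace ℂ (Fin d) // ‖ψ‖ = 1}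

/-- The energy eigenstate `|x⟩`. -/
noncomputable def basisState (x : Fin d) : PureState d :=
  ⟨EuclideanSpace.single x 1, by simp⟩

/-- The density operator `|ψ⟩⟨ψ|^{⊗ N}`. -/
noncomputable def copiesState (N : ℕ) (ψ : PureState d) : Matrix (Copies d N) (Copies d N) ℂ :=
  Matrix.of fun i j => (∏ k, ψ.1 (i k)) * star (∏ k, ψ.1 (j k))

/-- The projector on the totally symmetric subspace of `N` copies. -/
noncomputable def symProj (d N : ℕ) : Matrix (Copies d N) (Copies d N) ℂ :=
  ((Nat.factorial N : ℂ))⁻¹ • ∑ σ : Equiv.Perm (Fin N),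
    Matrix.of fun i j : Copies d N => if (fun k => i (σ k)) = j then (1 : ℂ) else 0

/-- The dimension of the totally symmetric subspace of `N` copies. -/
noncomputable def symDim (d N : ℕ) : ℝ := (symProj d N).trace.re

/-- `ρ ⊗ I^{⊗ (N' - N)}`, with `ρ` on the first `N` copies. -/
def tensorId {N N' : ℕ} (h : N ≤ N') (ρ : Matrix (Copies d N) (Copies d N) ℂ) :
    Matrix (Copies d N') (Copies d N') ℂ :=
  Matrix.of fun i j => ρ (fun k => i (Fin.castLE h k)) (fun k => j (Fin.castLE h k))
    * if ∀ k : Fin N', N ≤ (k : ℕ) → i k = j k then 1 else 0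

/-- The optimal universal cloner: a channel that maps `ψ^{⊗ N}` to
`(d_N / d_{N'}) P_{N'} (ψ^{⊗ N} ⊗ I^{⊗ (N' - N)}) P_{N'}` for every pure state `ψ`. -/
def IsOptimalCloner {N N' : ℕ} (h : N ≤ N')
    (M : Matrix (Copies d N) (Copies d N) ℂ →ₗ[ℂ] Matrix (Copies d N') (Copies d N') ℂ) : Prop :=
  IsChannel M ∧ ∀ ψ : PureState d, M (copiesState N ψ)
    = (symDim d N / symDim d N')
      • (symProj d N' * tensorId h (copiesState N ψ) * symProj d N')

/-- Universal quantum cloning: all pure states are to be cloned. -/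
noncomputable def quantumCloning (kT : ℝ) (E : Fin d → ℝ) (N N' : ℕ) :
    Task (PureState d) (Copies d N) (Copies d N') where
  β := 1 / kT
  energyIn := copiesEnergy E N
  energyOut := copiesEnergy E N'
  proj := symProj d N
  state := copiesState N
  obs := copiesState N'

/-- Classical cloning: the energy eigenstates are to be cloned. The input subspace is spanned by
the states `|x⟩^{⊗ N}`. -/
noncomputable def classicalCloning (kT : ℝ) (E : Fin d → ℝ) (N N' : ℕ) :
    Task (Fin d) (Copies d N) (Copies d N') where
  β := 1 / kT
  energyIn := copiesEnergy E N
  energyOut := copiesEnergy E N'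
  proj := Matrix.diagonal fun i => if ∃ x, ∀ k, i k = x then 1 else 0
  state := fun x => copiesState N (basisState x)
  obs := fun x => copiesState N' (basisState x)

/-- `ΔA_max`: the maximum free energy `E_max` of a pure state minus the free energy of the Gibbs
state. -/
noncomputable def maxFreeEnergyGap (kT : ℝ) (E : Fin d → ℝ) : ℝ :=
  (⨆ i, E i) - gibbsFreeEnergy kT E

end Cloning

end ThermoCloning

open ThermoCloning

/-!
Let `p` be the smallest Gibbs probability of a single system, attained at the level `x` of the
highest energy, let `m = N' - N`, and let `q = Tr[P_N Γ_A]`. All claims follow from one inequality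
between the accuracy `F` of a channel and its cost `c`,

  `F ≤ 2 ^ c * p ^ m`,

together with channels that saturate it for every `F` between `q * p ^ m` and `d_N / d_{N'}`.

The inequality (`accuracy_le_of_mem_costExponents`) tests the channel on the eigenstate `x`: the
Gibbs state `Γ_A` dominates `p ^ N |x⟩⟨x|^{⊗ N}`, and `Γ_B` has expectation value `p ^ (N + m)` in
`|x⟩^{⊗ (N + m)}`. The same test bounds the accuracy of the time-reversed task by `p ^ m`, for
quantum and for classical cloning; discarding `m` copies reaches this value
(`isGreatest_revAccuracies`). Hence both reverse entropies are `-log p ^ m`, which is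
`m ΔA_max / (kT ln 2)` (`exists_min_gibbsProb`).

Two further bounds are independent of `p`. As a quantum operation that agrees with a channel on the
symmetric subspace preserves the trace there, the cost is at least `log q`
(`symWeight_le_of_mem_costExponents`). The accuracy is at most `d_N / d_{N'}`
(`accuracy_le_symDim_div`), by averaging over all states; the average is taken over Gaussian vectors
instead of the unit sphere, since the Gaussian moments of order `n` are `n!` times the matrix
elements of the symmetric projector (`trace_mul_symProj_re_nonneg`).

Two quantum operations saturate everything. The operation
`X ↦ (d_N / d_{N'}) P_{N'} (X ⊗ I) P_{N'}` has accuracy `d_N / d_{N'}` and preserves the trace on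
the symmetric subspace because the partial trace of `P_{N'}` is a multiple of `P_N`
(`discard_symProj`). Every optimal cloner agrees with it on the symmetric subspace because product
states span the operators there (`eq_on_symProj_conj`), so that its cost follows from
`I ≤ p ^ (-m) Γ^{⊗ m}`. The operation `thermalOperation` maps `Γ_A` exactly to `q Γ_B`, so it has
the smallest cost, and has accuracy `q * p ^ m`. Mixtures of the two cover all accuracies in between
(`exists_channel_accuracy_cost`).

That the infimum in the cost of a channel is attained follows from the compactness of the set of
quantum operations (`isCompact_isQuantumOperation`); all other extrema are exhibited explicitly.
-/

set_option linter.unusedSectionVars false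

namespace ThermoCloning

open Matrix
open scoped ComplexOrder

/-! ### Positive operators and completely positive maps -/

section Operations

variable {A B C : Type} [Fintype A] [DecidableEq A] [Fintype B] [DecidableEq B]
  [Fintype C] [DecidableEq C]

theorem PosSemidef.eq_conjTranspose_mul_self {Q : Matrix A A ℂ} (hQ : Q.PosSemidef) :
    ∃ C : Matrix A A ℂ, Q = Cᴴ * C := by
  open scoped MatrixOrder in
  obtain ⟨C, hC⟩ := CStarAlgebra.nonneg_iff_eq_star_mul_self.mp hQ.nonneg
  exact ⟨C, hC⟩

theorem posSemidef_real_smul {c : ℝ} (hc : 0 ≤ c) {Q : Matrix A A ℂ} (hQ : Q.PosSemidef) :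
    (c • Q).PosSemidef := by
  have h : (0 : ℂ) ≤ (c : ℂ) := by exact_mod_cast hc
  have := hQ.smul h
  rwa [show (c : ℂ) • Q = c • Q from by ext; simp] at this

theorem PosSemidef.trace_mul_re_nonneg {X Y : Matrix A A ℂ} (hX : X.PosSemidef)
    (hY : Y.PosSemidef) : 0 ≤ (X * Y).trace.re := by
  obtain ⟨C, rfl⟩ := PosSemidef.eq_conjTranspose_mul_self hX
  rw [Matrix.mul_assoc, Matrix.trace_mul_comm]
  exact (Complex.le_def.1 (hY.mul_mul_conjTranspose_same C).trace_nonneg).1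

theorem PosSemidef.trace_re_nonneg {X : Matrix A A ℂ} (hX : X.PosSemidef) : 0 ≤ X.trace.re :=
  (Complex.le_def.1 hX.trace_nonneg).1

/-- The map `X ↦ ∑ s, K s * X * (K s)ᴴ` with Kraus operators `K s`. -/
def krausMap {S : Type} [Fintype S] (K : S → Matrix B A ℂ) :
    Matrix A A ℂ →ₗ[ℂ] Matrix B B ℂ where
  toFun X := ∑ s, K s * X * (K s)ᴴ
  map_add' X Y := by simp [Matrix.mul_add, Matrix.add_mul, Finset.sum_add_distrib]
  map_smul' c X := by simp [Finset.smul_sum]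

theorem krausMap_apply {S : Type} [Fintype S] (K : S → Matrix B A ℂ) (X : Matrix A A ℂ) :
    krausMap K X = ∑ s, K s * X * (K s)ᴴ := rfl

theorem isCompletelyPositive_krausMap {S : Type} [Fintype S] (K : S → Matrix B A ℂ) :
    IsCompletelyPositive (krausMap K) := by
  intro k M hM
  have h : ampliation (krausMap K) k M
      = ∑ s, kroneckerMap (· * ·) (K s) (1 : Matrix (Fin k) (Fin k) ℂ) * M
          * (kroneckerMap (· * ·) (K s) (1 : Matrix (Fin k) (Fin k) ℂ))ᴴ := by
    ext ⟨b, i⟩ ⟨b', j⟩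
    simp only [ampliation, of_apply, krausMap_apply, Matrix.sum_apply]
    refine Finset.sum_congr rfl fun s _ => ?_
    simp [Matrix.mul_apply, Fintype.sum_prod_type, Matrix.one_apply, conjTranspose_apply,
      kroneckerMap_apply, Finset.sum_mul, mul_assoc, apply_ite (starRingEnd ℂ)]
  rw [h]
  exact posSemidef_sum _ fun s _ => hM.mul_mul_conjTranspose_same _

theorem IsCompletelyPositive.add {Φ Ψ : Matrix A A ℂ →ₗ[ℂ] Matrix B B ℂ}
    (hΦ : IsCompletelyPositive Φ) (hΨ : IsCompletelyPositive Ψ) :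
    IsCompletelyPositive (Φ + Ψ) := fun k M hM => by
  convert (hΦ k M hM).add (hΨ k M hM) using 1
  ext; rfl

theorem IsCompletelyPositive.smul {c : ℝ} (hc : 0 ≤ c) {Φ : Matrix A A ℂ →ₗ[ℂ] Matrix B B ℂ}
    (hΦ : IsCompletelyPositive Φ) : IsCompletelyPositive (c • Φ) := fun k M hM => by
  convert posSemidef_real_smul hc (hΦ k M hM) using 1
  ext; rfl

theorem IsCompletelyPositive.comp {Ψ : Matrix B B ℂ →ₗ[ℂ] Matrix C C ℂ}
    {Φ : Matrix A A ℂ →ₗ[ℂ] Matrix B B ℂ} (hΨ : IsCompletelyPositive Ψ)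
    (hΦ : IsCompletelyPositive Φ) : IsCompletelyPositive (Ψ ∘ₗ Φ) := fun k M hM =>
  hΨ k _ (hΦ k M hM)

theorem IsCompletelyPositive.posSemidef {Φ : Matrix A A ℂ →ₗ[ℂ] Matrix B B ℂ}
    (hΦ : IsCompletelyPositive Φ) {X : Matrix A A ℂ} (hX : X.PosSemidef) :
    (Φ X).PosSemidef :=
  (hΦ 1 (X.submatrix Prod.fst Prod.fst) (hX.submatrix _)).submatrix fun b => (b, 0)

/-- The map `X ↦ K * X * Kᴴ`. -/
def conjBy (K : Matrix B A ℂ) : Matrix A A ℂ →ₗ[ℂ] Matrix B B ℂ := krausMap fun _ : Unit => K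

theorem conjBy_apply (K : Matrix B A ℂ) (X : Matrix A A ℂ) : conjBy K X = K * X * Kᴴ := by
  simp [conjBy, krausMap_apply]

theorem isCompletelyPositive_conjBy (K : Matrix B A ℂ) : IsCompletelyPositive (conjBy K) :=
  isCompletelyPositive_krausMap _

/-- The map `X ↦ Tr[Q X] σ`: measure the effect `Q` and prepare `σ`. -/
def measurePrepare (Q : Matrix A A ℂ) (σ : Matrix B B ℂ) :
    Matrix A A ℂ →ₗ[ℂ] Matrix B B ℂ where
  toFun X := (Q * X).trace • σ
  map_add' X Y := by simp [Matrix.mul_add, add_smul]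
  map_smul' c X := by simp [mul_smul]

theorem measurePrepare_apply (Q : Matrix A A ℂ) (σ : Matrix B B ℂ) (X : Matrix A A ℂ) :
    measurePrepare Q σ X = (Q * X).trace • σ := rfl

theorem isCompletelyPositive_measurePrepare {Q : Matrix A A ℂ} {σ : Matrix B B ℂ}
    (hQ : Q.PosSemidef) (hσ : σ.PosSemidef) : IsCompletelyPositive (measurePrepare Q σ) := by
  obtain ⟨C, rfl⟩ := PosSemidef.eq_conjTranspose_mul_self hQ
  obtain ⟨D, rfl⟩ := PosSemidef.eq_conjTranspose_mul_self hσ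
  -- compress by `C`, replace the state by the identity with weight its trace, compress by `Dᴴ`
  have h : measurePrepare (Cᴴ * C) (Dᴴ * D)
      = conjBy Dᴴ ∘ₗ
        (krausMap fun s : B × A => Matrix.single s.1 s.2 (1 : ℂ)) ∘ₗ
        conjBy C := by
    refine LinearMap.ext fun X => ?_
    have h1 : ∀ Y : Matrix A A ℂ,
        (krausMap fun s : B × A => Matrix.single s.1 s.2 (1 : ℂ)) Y
          = Y.trace • (1 : Matrix B B ℂ) := by
      intro Y
      ext b b'
      simp only [krausMap_apply, Fintype.sum_prod_type, Matrix.sum_apply, conjTranspose_single,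
        star_one, Matrix.single_mul_mul_single, Matrix.smul_apply, Matrix.one_apply, smul_eq_mul,
        one_mul, mul_one, Matrix.single_apply]
      by_cases hb : b = b'
      · subst hb
        simp [Matrix.trace]
      · rw [if_neg hb, mul_zero]
        refine Finset.sum_eq_zero fun x _ => Finset.sum_eq_zero fun y _ => if_neg ?_
        rintro ⟨h1, h2⟩
        exact hb (h1.symm.trans h2)
    simp only [LinearMap.comp_apply, h1, conjBy_apply, measurePrepare_apply,
      conjTranspose_conjTranspose]
    rw [Matrix.mul_assoc, Matrix.trace_mul_comm]
    simp
  rw [h]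
  exact (isCompletelyPositive_conjBy _).comp
    ((isCompletelyPositive_krausMap _).comp (isCompletelyPositive_conjBy _))

theorem IsChannel.isQuantumOperation {Φ : Matrix A A ℂ →ₗ[ℂ] Matrix B B ℂ} (hΦ : IsChannel Φ) :
    IsQuantumOperation Φ :=
  ⟨hΦ.1, fun ρ hρ => by rw [hΦ.2, hρ.2]; simp⟩

end Operations

/-! ### The projector on the symmetric subspace -/

section Symmetric

variable {d n : ℕ}

/-- The occupation number of the level `a` in the product basis vector `i`. -/
def occ (i : Copies d n) (a : Fin d) : ℕ := Fintype.card {k // i k = a}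

theorem occ_comp_perm (i : Copies d n) (σ : Equiv.Perm (Fin n)) :
    occ (fun k => i (σ k)) = occ i := by
  funext a
  exact Fintype.card_congr (σ.subtypeEquiv fun _ => Iff.rfl)

theorem exists_perm_of_occ_eq {i j : Copies d n} (h : occ i = occ j) :
    ∃ σ : Equiv.Perm (Fin n), (fun k => i (σ k)) = j := by
  have e : ∀ a, Nonempty ({k // j k = a} ≃ {k // i k = a}) := fun a =>
    Fintype.card_eq.1 (congrFun h a).symm
  refine ⟨Equiv.ofFiberEquiv fun a => (e a).some, funext fun k => ?_⟩
  exact Equiv.ofFiberEquiv_map _ k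

theorem prod_eq_prod_pow_occ {R : Type*} [CommMonoid R] (v : Fin d → R) (i : Copies d n) :
    ∏ k, v (i k) = ∏ a, v a ^ occ i a := by
  rw [← Finset.prod_fiberwise Finset.univ i]
  refine Finset.prod_congr rfl fun a _ => ?_
  rw [Finset.prod_congr rfl (g := fun _ => v a) fun k hk => by rw [(Finset.mem_filter.1 hk).2],
    Finset.prod_const, occ, Fintype.card_subtype]

theorem sum_occ (i : Copies d n) : ∑ a, occ i a = n := by
  have := (Fintype.card_congr (Equiv.sigmaFiberEquiv i))
  rw [Fintype.card_sigma, Fintype.card_fin] at this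
  exact this

/-- The permutations that carry `i` to `j` form a coset of the stabilizer of `i`, which permutes the
copies within each level. -/
theorem card_perm_comp_eq (i j : Copies d n) :
    Fintype.card {σ : Equiv.Perm (Fin n) // (fun k => i (σ k)) = j}
      = if occ i = occ j then ∏ a, (occ i a).factorial else 0 := by
  split_ifs with h
  · obtain ⟨τ, rfl⟩ := exists_perm_of_occ_eq h
    have h1 : Fintype.card {σ : Equiv.Perm (Fin n) // i ∘ σ = i}
        = ∏ a, (occ i a).factorial := DomMulAct.stabilizer_card i
    rw [← h1]
    refine Fintype.card_congr ((Equiv.mulRight τ⁻¹).subtypeEquiv fun σ => ?_)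
    simp only [funext_iff, Function.comp, Equiv.coe_mulRight, Equiv.Perm.coe_mul]
    constructor
    · intro hσ k
      rw [hσ (τ⁻¹ k)]; simp
    · intro hσ k
      simpa using hσ (τ k)
  · rw [Fintype.card_eq_zero_iff]
    exact ⟨fun σ => h (by rw [← σ.2, occ_comp_perm])⟩

theorem symProj_apply (i j : Copies d n) :
    symProj d n i j = (n.factorial : ℂ)⁻¹ *
      ∑ σ : Equiv.Perm (Fin n), if (fun k => i (σ k)) = j then (1 : ℂ) else 0 := by
  simp [symProj, Matrix.sum_apply]

theorem symProj_apply_occ (i j : Copies d n) :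
    symProj d n i j = if occ i = occ j then
      (n.factorial : ℂ)⁻¹ * ∏ a, ((occ i a).factorial : ℂ) else 0 := by
  rw [symProj_apply, Finset.sum_boole, ← Fintype.card_subtype, card_perm_comp_eq]
  split_ifs <;> simp

theorem symProj_isHermitian : (symProj d n)ᴴ = symProj d n := by
  ext i j
  rw [conjTranspose_apply, symProj_apply_occ, symProj_apply_occ]
  by_cases h : occ i = occ j
  · simp [h]
  · rw [if_neg h, if_neg (Ne.symm h), star_zero]

theorem symProj_comp_left (i j : Copies d n) (σ : Equiv.Perm (Fin n)) :
    symProj d n (fun k => i (σ k)) j = symProj d n i j := by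
  simp only [symProj_apply_occ, occ_comp_perm]

theorem symProj_mul_apply {B : Type} (X : Matrix (Copies d n) B ℂ) (i : Copies d n) (b : B) :
    (symProj d n * X) i b = (n.factorial : ℂ)⁻¹ *
      ∑ σ : Equiv.Perm (Fin n), X (fun k => i (σ k)) b := by
  simp only [Matrix.mul_apply, symProj_apply, mul_assoc, ← Finset.mul_sum, Finset.sum_mul]
  rw [Finset.sum_comm]
  simp

theorem symProj_mul_of_invariant {B : Type} {X : Matrix (Copies d n) B ℂ}
    (hX : ∀ (σ : Equiv.Perm (Fin n)) i b, X (fun k => i (σ k)) b = X i b) :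
    symProj d n * X = X := by
  ext i b
  rw [symProj_mul_apply]
  simp [hX, Fintype.card_perm, Nat.factorial_ne_zero]

theorem symProj_mul_self : symProj d n * symProj d n = symProj d n :=
  symProj_mul_of_invariant fun σ i b => symProj_comp_left i b σ

theorem symProj_posSemidef : (symProj d n).PosSemidef := by
  have h := posSemidef_conjTranspose_mul_self (symProj d n)
  rwa [symProj_isHermitian, symProj_mul_self] at h

theorem one_sub_symProj_posSemidef : (1 - symProj d n).PosSemidef := by
  have h := posSemidef_conjTranspose_mul_self (1 - symProj d n)
  rwa [conjTranspose_sub, symProj_isHermitian, conjTranspose_one, Matrix.mul_sub, Matrix.sub_mul,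
    Matrix.sub_mul, symProj_mul_self, Matrix.one_mul, Matrix.one_mul, Matrix.mul_one,
    sub_self, sub_zero] at h

theorem symProj_mul_diagonal {g : Copies d n → ℂ}
    (hg : ∀ (σ : Equiv.Perm (Fin n)) i, g (fun k => i (σ k)) = g i) :
    symProj d n * Matrix.diagonal g = Matrix.diagonal g * symProj d n := by
  ext i j
  rw [Matrix.mul_diagonal, Matrix.diagonal_mul, mul_comm, symProj_apply_occ]
  split_ifs with h
  · obtain ⟨σ, rfl⟩ := exists_perm_of_occ_eq h
    rw [hg]
  · simp

theorem trace_symProj : (symProj d n).trace = (symDim d n : ℂ) :=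
  Complex.ext rfl (by
    simpa using (Complex.le_def.1 (symProj_posSemidef (d := d) (n := n)).trace_nonneg).2.symm)

theorem symDim_pos (hd : 0 < d) : 0 < symDim d n := by
  have h0 : ∀ i : Copies d n, symProj d n i i
      = (((n.factorial : ℝ)⁻¹ * ∏ a, ((occ i a).factorial : ℝ) : ℝ) : ℂ) := fun i => by
    rw [symProj_apply_occ]; push_cast; simp
  have : Nonempty (Copies d n) := ⟨fun _ => ⟨0, hd⟩⟩
  simp only [symDim, Matrix.trace, Matrix.diag, h0, Complex.re_sum, Complex.ofReal_re]
  refine Finset.sum_pos (fun i _ => ?_) Finset.univ_nonempty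
  have : ∀ k : ℕ, 0 < (k.factorial : ℝ) := fun k => by exact_mod_cast k.factorial_pos
  exact mul_pos (inv_pos.2 (this n)) (Finset.prod_pos fun a _ => this _)

/-! ### Product vectors -/

/-- The product vector `v ⊗ ⋯ ⊗ v`. -/
def tensorPow (n : ℕ) (v : Fin d → ℂ) (i : Copies d n) : ℂ := ∏ k, v (i k)

/-- The rank-one operator `|v⟩⟨v|^{⊗ n}` of a vector `v` of arbitrary norm. -/
def tensorPowOp (n : ℕ) (v : Fin d → ℂ) : Matrix (Copies d n) (Copies d n) ℂ :=
  vecMulVec (tensorPow n v) (star (tensorPow n v))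

theorem copiesState_eq (n : ℕ) (ψ : PureState d) :
    copiesState n ψ = tensorPowOp n ψ.1 := rfl

theorem tensorPowOp_apply (v : Fin d → ℂ) (i j : Copies d n) :
    tensorPowOp n v i j = (∏ k, v (i k)) * star (∏ k, v (j k)) := rfl

theorem tensorPowOp_posSemidef (v : Fin d → ℂ) : (tensorPowOp n v).PosSemidef :=
  posSemidef_vecMulVec_self_star _

theorem tensorPowOp_conjTranspose (v : Fin d → ℂ) : (tensorPowOp n v)ᴴ = tensorPowOp n v :=
  (tensorPowOp_posSemidef v).1

theorem symProj_mul_tensorPowOp (v : Fin d → ℂ) :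
    symProj d n * tensorPowOp n v = tensorPowOp n v :=
  symProj_mul_of_invariant fun σ i b => by
    rw [tensorPowOp_apply, tensorPowOp_apply, Equiv.prod_comp σ fun k => v (i k)]

theorem tensorPowOp_mul_symProj (v : Fin d → ℂ) :
    tensorPowOp n v * symProj d n = tensorPowOp n v := by
  rw [← tensorPowOp_conjTranspose, ← symProj_isHermitian, ← conjTranspose_mul,
    symProj_mul_tensorPowOp]

theorem trace_tensorPowOp_mul (v w : Fin d → ℂ) :
    (tensorPowOp n v * tensorPowOp n w).trace
      = (∑ a, star (v a) * w a) ^ n * (∑ a, star (w a) * v a) ^ n := by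
  have h : ∀ x y : Fin d → ℂ, star (tensorPow n x) ⬝ᵥ tensorPow n y
      = (∑ a, star (x a) * y a) ^ n := by
    intro x y
    rw [Fintype.sum_pow]
    simp [dotProduct, tensorPow, Finset.prod_mul_distrib]
  rw [tensorPowOp, tensorPowOp, vecMulVec_mul_vecMulVec, vecMulVec_smul, trace_smul,
    trace_vecMulVec, dotProduct_comm (tensorPow n v), h, h, smul_eq_mul]

theorem trace_tensorPowOp (v : Fin d → ℂ) :
    (tensorPowOp n v).trace = (∑ a, star (v a) * v a) ^ n := by
  rw [Fintype.sum_pow]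
  simp [Matrix.trace, tensorPowOp_apply, Finset.prod_mul_distrib, mul_comm]

theorem PureState.sum_star_mul_self (ψ : PureState d) :
    ∑ a, star (ψ.1 a) * ψ.1 a = 1 := by
  have h := EuclideanSpace.inner_eq_star_dotProduct ψ.1 ψ.1
  rw [inner_self_eq_norm_sq_to_K, ψ.2] at h
  simp only [dotProduct, Pi.star_apply] at h
  rw [← Finset.sum_congr rfl fun a _ => mul_comm (ψ.1 a) (star (ψ.1 a))]
  simpa using h.symm

theorem copiesState_isDensity (ψ : PureState d) : IsDensity (copiesState n ψ) :=
  ⟨tensorPowOp_posSemidef _, by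
    rw [copiesState_eq, trace_tensorPowOp, ψ.sum_star_mul_self, one_pow]⟩

theorem copiesState_basisState (n : ℕ) (x : Fin d) :
    copiesState n (basisState x) = Matrix.single (fun _ => x) (fun _ => x) 1 := by
  have h : ∀ i : Copies d n, (∏ k, (basisState x).1 (i k)) = if (fun _ => x) = i then 1 else 0 := by
    intro i
    simp only [basisState, PiLp.single_apply, Finset.prod_boole, Finset.mem_univ,
      true_implies, funext_iff]
    simp only [eq_comm]
  ext i j
  simp only [copiesState, of_apply, h, Matrix.single_apply]
  by_cases h1 : (fun _ => x) = i <;> by_cases h2 : (fun _ => x) = j <;> simp [h1, h2]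

end Symmetric

/-! ### Adding and discarding copies -/

section Attach

variable {d N m : ℕ}

/-- The labels of the first `N` of `N + m` copies. -/
def firstCopies (i : Copies d (N + m)) : Copies d N := fun k => i (Fin.castAdd m k)

/-- The labels of the last `m` of `N + m` copies. -/
def lastCopies (i : Copies d (N + m)) : Copies d m := fun k => i (Fin.natAdd N k)

@[simp] theorem firstCopies_append (a : Copies d N) (b : Copies d m) :
    firstCopies (Fin.append a b) = a := by
  funext k; simp [firstCopies]

@[simp] theorem lastCopies_append (a : Copies d N) (b : Copies d m) :
    lastCopies (Fin.append a b) = b := by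
  funext k; simp [lastCopies]

theorem append_firstCopies_lastCopies (i : Copies d (N + m)) :
    Fin.append (firstCopies i) (lastCopies i) = i := Fin.append_castAdd_natAdd

theorem eq_append_iff (i : Copies d (N + m)) (a : Copies d N) (b : Copies d m) :
    i = Fin.append a b ↔ firstCopies i = a ∧ lastCopies i = b := by
  constructor
  · rintro rfl; simp
  · rintro ⟨rfl, rfl⟩; rw [append_firstCopies_lastCopies]

theorem sum_copies_add {R : Type*} [AddCommMonoid R] (f : Copies d (N + m) → R) :
    ∑ i, f i = ∑ a : Copies d N, ∑ b : Copies d m, f (Fin.append a b) := by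
  rw [← Fintype.sum_prod_type']
  exact ((Fin.appendEquiv N m).sum_comp f).symm

theorem prod_copies_add {R : Type*} [CommMonoid R] (v : Fin d → R) (i : Copies d (N + m)) :
    ∏ k, v (i k) = (∏ k, v (firstCopies i k)) * ∏ k, v (lastCopies i k) :=
  Fin.prod_univ_add fun k => v (i k)

/-- The map `X ↦ X ⊗ diag w` that adds `m` copies in the unnormalized diagonal state `w`. -/
def attach (w : Copies d m → ℝ) : Matrix (Copies d N) (Copies d N) ℂ →ₗ[ℂ]
    Matrix (Copies d (N + m)) (Copies d (N + m)) ℂ where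
  toFun X := Matrix.of fun i j => X (firstCopies i) (firstCopies j) *
    if lastCopies i = lastCopies j then (w (lastCopies i) : ℂ) else 0
  map_add' X Y := by ext; simp only [of_apply, Matrix.add_apply, add_mul]
  map_smul' c X := by ext; simp only [of_apply, Matrix.smul_apply, smul_eq_mul, mul_assoc,
    RingHom.id_apply]

theorem attach_apply (w : Copies d m → ℝ) (X : Matrix (Copies d N) (Copies d N) ℂ)
    (i j : Copies d (N + m)) : attach w X i j = X (firstCopies i) (firstCopies j) *
      if lastCopies i = lastCopies j then (w (lastCopies i) : ℂ) else 0 := rfl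

theorem tensorId_eq_attach (h : N ≤ N + m) (X : Matrix (Copies d N) (Copies d N) ℂ) :
    tensorId h X = attach 1 X := by
  ext i j
  have hij : (∀ k : Fin (N + m), N ≤ (k : ℕ) → i k = j k) ↔ lastCopies i = lastCopies j := by
    rw [funext_iff]
    constructor
    · intro hk k
      exact hk _ (by simp)
    · intro hk k hNk
      obtain ⟨l, hl⟩ := Nat.exists_eq_add_of_le hNk
      have hk' : k = Fin.natAdd N ⟨l, by omega⟩ := Fin.ext hl
      rw [hk']
      exact hk _
  simp only [tensorId, of_apply, attach_apply, hij, Pi.one_apply, Complex.ofReal_one]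
  rfl

theorem isCompletelyPositive_attach {w : Copies d m → ℝ} (hw : 0 ≤ w) :
    IsCompletelyPositive (attach (N := N) w) := by
  have h : attach (N := N) w = krausMap fun b => Matrix.of fun i a =>
      if i = Fin.append a b then ((√(w b) : ℝ) : ℂ) else 0 := by
    refine LinearMap.ext fun X => Matrix.ext fun i j => ?_
    have hs : ((√(w (lastCopies i)) : ℝ) : ℂ) * ((√(w (lastCopies i)) : ℝ) : ℂ)
        = (w (lastCopies i) : ℂ) := by
      rw [← Complex.ofReal_mul, Real.mul_self_sqrt (hw _)]
    simp only [krausMap_apply, Matrix.sum_apply, Matrix.mul_apply, of_apply, conjTranspose_apply,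
      eq_append_iff, ite_and, apply_ite star, star_zero, ite_mul, mul_ite, zero_mul, mul_zero,
      Finset.sum_ite_eq, Finset.mem_univ, if_true, attach_apply]
    rw [eq_comm]
    split_ifs with hij
    · rw [← hij, ← hs, Complex.star_def, Complex.conj_ofReal]
      ring
    · rfl
  rw [h]
  exact isCompletelyPositive_krausMap _

theorem trace_attach (w : Copies d m → ℝ) (X : Matrix (Copies d N) (Copies d N) ℂ) :
    (attach w X).trace = X.trace * ((∑ b, w b : ℝ) : ℂ) := by
  simp [Matrix.trace, sum_copies_add, attach_apply, Finset.sum_mul_sum]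

theorem attach_diagonal (w : Copies d m → ℝ) (g : Copies d N → ℂ) :
    attach w (Matrix.diagonal g)
      = Matrix.diagonal fun i => g (firstCopies i) * (w (lastCopies i) : ℂ) := by
  ext i j
  rw [attach_apply]
  by_cases h : i = j
  · subst h; simp
  · rw [Matrix.diagonal_apply_ne _ h]
    by_cases h1 : firstCopies i = firstCopies j
    · rw [if_neg, mul_zero]
      intro h2
      exact h (by rw [← append_firstCopies_lastCopies i, h1, h2, append_firstCopies_lastCopies])
    · rw [Matrix.diagonal_apply_ne _ h1, zero_mul]

/-- The partial trace over the last `m` copies. -/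
def discard : Matrix (Copies d (N + m)) (Copies d (N + m)) ℂ →ₗ[ℂ]
    Matrix (Copies d N) (Copies d N) ℂ where
  toFun Y := Matrix.of fun a a' => ∑ b, Y (Fin.append a b) (Fin.append a' b)
  map_add' X Y := by ext; simp [Finset.sum_add_distrib]
  map_smul' c X := by ext; simp [Finset.mul_sum]

theorem discard_apply (Y : Matrix (Copies d (N + m)) (Copies d (N + m)) ℂ) (a a' : Copies d N) :
    discard Y a a' = ∑ b, Y (Fin.append a b) (Fin.append a' b) := rfl

theorem trace_discard (Y : Matrix (Copies d (N + m)) (Copies d (N + m)) ℂ) :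
    (discard Y).trace = Y.trace := by
  simp [Matrix.trace, discard_apply, sum_copies_add]

theorem isChannel_discard : IsChannel (discard (d := d) (N := N) (m := m)) := by
  refine ⟨?_, trace_discard⟩
  have h : discard (d := d) (N := N) (m := m) = krausMap fun b => Matrix.of fun a i =>
      if i = Fin.append a b then (1 : ℂ) else 0 := by
    refine LinearMap.ext fun X => Matrix.ext fun i j => ?_
    simp [krausMap_apply, Matrix.sum_apply, Matrix.mul_apply, discard_apply]
  rw [h]
  exact isCompletelyPositive_krausMap _

/-- The partial trace is dual to tensoring with the identity. -/
theorem trace_mul_attach_one (Y : Matrix (Copies d (N + m)) (Copies d (N + m)) ℂ)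
    (X : Matrix (Copies d N) (Copies d N) ℂ) :
    (Y * attach 1 X).trace = (discard Y * X).trace := by
  simp only [Matrix.trace, Matrix.diag, Matrix.mul_apply, sum_copies_add, attach_apply,
    firstCopies_append, lastCopies_append, discard_apply, Finset.sum_mul, Pi.one_apply,
    Complex.ofReal_one, mul_ite, mul_one, mul_zero, Finset.sum_ite_eq', Finset.mem_univ, if_true]
  exact Finset.sum_congr rfl fun a _ => Finset.sum_comm

theorem discard_tensorPowOp (v : Fin d → ℂ) :
    discard (tensorPowOp (N + m) v) = (∑ a, star (v a) * v a) ^ m • tensorPowOp N v := by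
  ext a a'
  simp only [discard_apply, tensorPowOp_apply, prod_copies_add, firstCopies_append,
    lastCopies_append, Matrix.smul_apply, smul_eq_mul, Fintype.sum_pow, Finset.sum_mul]
  refine Finset.sum_congr rfl fun b _ => ?_
  rw [Finset.prod_mul_distrib, star_mul', star_prod, star_prod]
  ring

theorem occ_snoc (i : Copies d N) (x a : Fin d) :
    occ (Fin.snoc i x : Copies d (N + 1)) a = occ i a + if x = a then 1 else 0 := by
  have h : ∀ {n : ℕ} (i : Copies d n), occ i a = ∑ k, if i k = a then 1 else 0 := by
    intro n i
    rw [occ, Fintype.card_subtype, Finset.card_filter]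
  rw [h, h, Fin.sum_univ_castSucc]
  simp

/-- Discarding one copy maps the symmetric projector to a multiple of the symmetric projector. -/
theorem sum_symProj_snoc (i j : Copies d N) :
    ∑ x, symProj d (N + 1) (Fin.snoc i x) (Fin.snoc j x)
      = (((N : ℝ) + d) / (N + 1) : ℝ) * symProj d N i j := by
  have hf : ∀ x, ∏ a, ((occ (Fin.snoc i x : Copies d (N + 1)) a).factorial : ℂ)
      = ((occ i x : ℂ) + 1) * ∏ a, ((occ i a).factorial : ℂ) := by
    intro x
    have : ∀ a, ((occ (Fin.snoc i x : Copies d (N + 1)) a).factorial : ℂ)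
        = (if x = a then (occ i x : ℂ) + 1 else 1) * ((occ i a).factorial : ℂ) := by
      intro a
      rw [occ_snoc]
      split_ifs with h
      · rw [Nat.factorial_succ, h]; push_cast; ring
      · simp
    rw [Finset.prod_congr rfl fun a _ => this a, Finset.prod_mul_distrib, Finset.prod_ite_eq,
      if_pos (Finset.mem_univ x)]
  have ho : ∀ x, occ (Fin.snoc i x : Copies d (N + 1)) = occ (Fin.snoc j x : Copies d (N + 1))
      ↔ occ i = occ j := by
    intro x
    simp only [funext_iff, occ_snoc, add_left_inj]
  simp only [symProj_apply_occ, ho, hf]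
  split_ifs with h
  · have hs : ∑ x, ((occ i x : ℂ) + 1) = N + d := by
      have := sum_occ i
      rw [Finset.sum_add_distrib, ← Nat.cast_sum, this]
      simp
    rw [← Finset.mul_sum, ← Finset.sum_mul, hs, Nat.factorial_succ]
    have h1 : (N.factorial : ℂ) ≠ 0 := by exact_mod_cast N.factorial_ne_zero
    have h2 : (N : ℂ) + 1 ≠ 0 := by exact_mod_cast N.succ_ne_zero
    push_cast
    field_simp
  · simp

theorem sum_copies_succ {R : Type*} [AddCommMonoid R] (f : Copies d (m + 1) → R) :
    ∑ b, f b = ∑ b : Copies d m, ∑ x, f (Fin.snoc b x) := by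
  rw [← (Fin.snocEquiv fun _ : Fin (m + 1) => Fin d).sum_comp, Fintype.sum_prod_type_right]
  rfl

theorem append_snoc (a : Copies d N) (b : Copies d m) (x : Fin d) :
    (Fin.append a (Fin.snoc b x : Copies d (m + 1)) : Copies d (N + (m + 1)))
      = (Fin.snoc (Fin.append a b) x : Copies d (N + m + 1)) := by
  refine ((eq_append_iff (m := m + 1) (Fin.snoc (Fin.append a b) x : Copies d (N + m + 1)) a
    (Fin.snoc b x : Copies d (m + 1))).2 ⟨funext fun k => ?_, funext fun k => ?_⟩).symm
  · exact (Fin.snoc_castSucc (α := fun _ => Fin d) x (Fin.append a b) (Fin.castAdd m k)).trans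
      (Fin.append_left a b k)
  · refine Fin.lastCases ?_ (fun k => ?_) k
    · exact (Fin.snoc_last (α := fun _ => Fin d) x (Fin.append a b)).trans
        (Fin.snoc_last (α := fun _ => Fin d) x b).symm
    · exact ((Fin.snoc_castSucc (α := fun _ => Fin d) x (Fin.append a b) (Fin.natAdd N k)).trans
        (Fin.append_right a b k)).trans (Fin.snoc_castSucc (α := fun _ => Fin d) x b k).symm

/-- Discarding several copies, one at a time, maps the symmetric projector to a multiple of the
symmetric projector. -/
theorem exists_discard_symProj (N m : ℕ) : ∃ c : ℝ,
    discard (N := N) (symProj d (N + m)) = (c : ℂ) • symProj d N := by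
  induction m with
  | zero =>
    refine ⟨1, ?_⟩
    ext a a'
    have h : ∀ (a : Copies d N) (b : Copies d 0), Fin.append a b = a := fun a b => by
      rw [Subsingleton.elim b Fin.elim0, Fin.append_elim0]; rfl
    rw [discard_apply, Fintype.sum_unique, h, h, Complex.ofReal_one, one_smul]
    rfl
  | succ m ih =>
    obtain ⟨c, hc⟩ := ih
    refine ⟨((N + m : ℕ) + d : ℝ) / ((N + m : ℕ) + 1) * c, ?_⟩
    ext a a'
    rw [discard_apply, sum_copies_succ]
    simp only [append_snoc]
    refine (Finset.sum_congr rfl fun b _ => sum_symProj_snoc (N := N + m) _ _).trans ?_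
    rw [← Finset.mul_sum, ← discard_apply, hc]
    simp [mul_assoc]

/-- The constant of proportionality is found by comparing traces. -/
theorem discard_symProj (hd : 0 < d) : discard (N := N) (symProj d (N + m))
    = ((symDim d (N + m) / symDim d N : ℝ) : ℂ) • symProj d N := by
  obtain ⟨c, hc⟩ := exists_discard_symProj (d := d) N m
  have h := congrArg Matrix.trace hc
  rw [trace_discard, trace_smul, trace_symProj, trace_symProj, smul_eq_mul] at h
  have h' : symDim d (N + m) = c * symDim d N := by exact_mod_cast h
  rw [hc, h', mul_div_cancel_right₀ _ (symDim_pos hd).ne']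

end Attach

/-! ### Averaging over product vectors -/

section Average

open MeasureTheory

variable {d n : ℕ}

/-- A product operator is a nonnegative multiple of a pure product state. -/
theorem exists_tensorPowOp_eq_smul (hd : 0 < d) (n : ℕ) (v : Fin d → ℂ) :
    ∃ (ψ : PureState d) (c : ℝ), 0 ≤ c ∧ tensorPowOp n v = (c : ℂ) • copiesState n ψ := by
  by_cases hv : v = 0
  · refine ⟨basisState ⟨0, hd⟩, if n = 0 then 1 else 0, by split_ifs <;> norm_num, ?_⟩
    ext i j
    rw [hv, Matrix.smul_apply, copiesState_eq, tensorPowOp_apply, tensorPowOp_apply]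
    rcases Nat.eq_zero_or_pos n with rfl | hn
    · simp
    · have : Nonempty (Fin n) := ⟨⟨0, hn⟩⟩
      simp [hn.ne']
  · set w : EuclideanSpace ℂ (Fin d) := WithLp.toLp 2 v with hw
    have hw0 : ‖w‖ ≠ 0 := by
      rw [norm_ne_zero_iff]
      intro h
      exact hv (congrArg WithLp.ofLp h)
    refine ⟨⟨((‖w‖⁻¹ : ℝ) : ℂ) • w, by
      rw [norm_smul, Complex.norm_real, norm_inv, norm_norm, inv_mul_cancel₀ hw0]⟩,
      (‖w‖ ^ n) ^ 2, by positivity, ?_⟩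
    ext i j
    have hwc : (‖w‖ : ℂ) ≠ 0 := by exact_mod_cast hw0
    simp only [Matrix.smul_apply, copiesState_eq, tensorPowOp_apply, PiLp.smul_apply, smul_eq_mul,
      Finset.prod_mul_distrib, Finset.prod_const, Finset.card_univ, Fintype.card_fin, star_mul',
      star_pow, Complex.star_def, Complex.conj_ofReal, hw]
    rw [← hw]
    have h1 : ((‖w‖ : ℂ) ^ n) ^ 2 * ((‖w‖ : ℂ)⁻¹ ^ n) ^ 2 = 1 := by
      rw [← mul_pow, ← mul_pow, mul_inv_cancel₀ hwc, one_pow, one_pow]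
    push_cast
    linear_combination (-(∏ k, v (i k)) * (starRingEnd ℂ) (∏ k, v (j k))) * h1

/-- Orthogonality of the characters `t ↦ ζ ^ (t * a)` of the group of roots of unity. -/
theorem sum_rootOfUnity_pow {K : ℕ} {ζ : ℂ} (hζ : IsPrimitiveRoot ζ K) {a b : ℕ} (ha : a < K)
    (hb : b < K) :
    ∑ t : Fin K, (ζ ^ (t : ℕ)) ^ a * star (ζ ^ (t : ℕ)) ^ b = if a = b then (K : ℂ) else 0 := by
  have hn : ‖ζ‖ = 1 := hζ.norm'_eq_one (by omega)
  have h1 : ζ * star ζ = 1 := by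
    rw [Complex.star_def, Complex.mul_conj, Complex.normSq_eq_norm_sq, hn]; simp
  have h0 : ζ ≠ 0 := fun h => by simp [h] at hn
  have hterm : ∀ t : Fin K, (ζ ^ (t : ℕ)) ^ a * star (ζ ^ (t : ℕ)) ^ b
      = (ζ ^ a * star ζ ^ b) ^ (t : ℕ) := by
    intro t
    rw [star_pow]; ring
  rw [Finset.sum_congr rfl fun t _ => hterm t, Fin.sum_univ_eq_sum_range fun t =>
    (ζ ^ a * star ζ ^ b) ^ t]
  split_ifs with hab
  · rw [hab, ← mul_pow, h1]; simp
  · have hne : ζ ^ a * star ζ ^ b ≠ 1 := by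
      intro h
      apply hab
      apply hζ.pow_inj ha hb
      calc ζ ^ a = ζ ^ a * (ζ * star ζ) ^ b := by rw [h1]; simp
        _ = (ζ ^ a * star ζ ^ b) * ζ ^ b := by ring
        _ = ζ ^ b := by rw [h, one_mul]
    rw [geom_sum_eq hne, mul_pow, ← pow_mul, mul_comm a, pow_mul, hζ.pow_eq_one, ← pow_mul,
      mul_comm b, pow_mul, ← star_pow, hζ.pow_eq_one]
    simp

theorem trace_mul_tensorPowOp (G : Matrix (Copies d n) (Copies d n) ℂ) (v : Fin d → ℂ) :
    (G * tensorPowOp n v).trace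
      = ∑ i, ∑ j, G i j * ∏ a, v a ^ occ j a * star (v a) ^ occ i a := by
  simp only [Matrix.trace, Matrix.diag, Matrix.mul_apply, tensorPowOp_apply]
  refine Finset.sum_congr rfl fun i _ => Finset.sum_congr rfl fun j _ => ?_
  rw [star_prod, prod_eq_prod_pow_occ v, prod_eq_prod_pow_occ (fun a => star (v a)),
    Finset.prod_mul_distrib]

/-- Averaging a nonnegative expectation value over the phases of the components of the vector:
only the matrix elements between basis vectors of equal occupation numbers survive. -/
theorem sum_occ_eq_nonneg {G : Matrix (Copies d n) (Copies d n) ℂ}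
    (hG : ∀ v, 0 ≤ (G * tensorPowOp n v).trace.re) {r : Fin d → ℝ} (hr : 0 ≤ r) :
    0 ≤ ∑ i, ∑ j, (if occ j = occ i then (G i j).re else 0) * ∏ a, r a ^ occ j a := by
  set ζ : ℂ := Complex.exp (2 * Real.pi * Complex.I / (n + 1 : ℕ))
  have hζ : IsPrimitiveRoot ζ (n + 1) := Complex.isPrimitiveRoot_exp _ n.succ_ne_zero
  have hocc : ∀ (i : Copies d n) a, occ i a < n + 1 := fun i a => by
    have := Finset.single_le_sum (f := occ i) (fun _ _ => Nat.zero_le _) (Finset.mem_univ a)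
    rw [sum_occ] at this
    omega
  have key : ∑ ω : Fin d → Fin (n + 1),
      (G * tensorPowOp n fun a => (√(r a) : ℂ) * ζ ^ (ω a : ℕ)).trace
      = ((n + 1 : ℕ) : ℂ) ^ d *
        ∑ i, ∑ j, (if occ j = occ i then G i j else 0) * ((∏ a, r a ^ occ j a : ℝ) : ℂ) := by
    simp only [trace_mul_tensorPowOp]
    rw [Finset.sum_comm, Finset.mul_sum]
    refine Finset.sum_congr rfl fun i _ => ?_
    rw [Finset.sum_comm, Finset.mul_sum]
    refine Finset.sum_congr rfl fun j _ => ?_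
    rw [← Finset.mul_sum]
    have h := Finset.prod_univ_sum (fun _ : Fin d => (Finset.univ : Finset (Fin (n + 1))))
      fun a t => ((√(r a) : ℂ) * ζ ^ (t : ℕ)) ^ occ j a
        * star ((√(r a) : ℂ) * ζ ^ (t : ℕ)) ^ occ i a
    rw [Fintype.piFinset_univ] at h
    rw [← h]
    have h2 : ∀ a, ∑ t : Fin (n + 1), ((√(r a) : ℂ) * ζ ^ (t : ℕ)) ^ occ j a
        * star ((√(r a) : ℂ) * ζ ^ (t : ℕ)) ^ occ i a
        = if occ j a = occ i a then ((n + 1 : ℕ) : ℂ) * ((r a ^ occ j a : ℝ) : ℂ) else 0 := by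
      intro a
      have h3 : ∀ t : Fin (n + 1), ((√(r a) : ℂ) * ζ ^ (t : ℕ)) ^ occ j a
          * star ((√(r a) : ℂ) * ζ ^ (t : ℕ)) ^ occ i a
          = ((√(r a) : ℂ) ^ occ j a * (√(r a) : ℂ) ^ occ i a)
            * ((ζ ^ (t : ℕ)) ^ occ j a * star (ζ ^ (t : ℕ)) ^ occ i a) := by
        intro t
        rw [star_mul', Complex.star_def, Complex.conj_ofReal]; ring
      rw [Finset.sum_congr rfl fun t _ => h3 t, ← Finset.mul_sum,
        sum_rootOfUnity_pow hζ (hocc j a) (hocc i a)]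
      split_ifs with hij
      · rw [← hij, ← mul_pow, ← Complex.ofReal_mul, Real.mul_self_sqrt (hr a)]
        push_cast; ring
      · rw [mul_zero]
    rw [Finset.prod_congr rfl fun a _ => h2 a]
    by_cases hij : occ j = occ i
    · simp [hij, Finset.prod_mul_distrib]
      ring
    · obtain ⟨a, ha⟩ := Function.ne_iff.1 hij
      rw [if_neg hij, Finset.prod_eq_zero (Finset.mem_univ a) (if_neg ha)]
      simp
  have h0 : 0 ≤ (∑ ω : Fin d → Fin (n + 1),
      (G * tensorPowOp n fun a => (√(r a) : ℂ) * ζ ^ (ω a : ℕ)).trace).re := by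
    rw [Complex.re_sum]
    exact Finset.sum_nonneg fun ω _ => hG _
  rw [key, ← Complex.ofReal_natCast, ← Complex.ofReal_pow, Complex.re_ofReal_mul] at h0
  have h1 := (mul_nonneg_iff_of_pos_left (by positivity)).1 h0
  simp only [Complex.re_sum, Complex.re_mul_ofReal, apply_ite Complex.re, Complex.zero_re] at h1
  exact h1

/-- The absolute value makes the integrand nonnegative off the half-line as well. -/
theorem integrable_abs_pow_mul_exp (k : ℕ) :
    Integrable (fun x : ℝ => |x| ^ k * Real.exp (-x)) (volume.restrict (Set.Ioi 0)) := by
  have h := Real.GammaIntegral_convergent (s := k + 1) (by positivity)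
  refine (integrableOn_congr_fun (fun x hx => ?_) measurableSet_Ioi).1 h
  rw [abs_of_pos (Set.mem_Ioi.1 hx), add_sub_cancel_right, Real.rpow_natCast, mul_comm]

theorem integral_abs_pow_mul_exp (k : ℕ) :
    ∫ x : ℝ in Set.Ioi 0, |x| ^ k * Real.exp (-x) = k.factorial := by
  rw [← Real.Gamma_nat_eq_factorial, Real.Gamma_eq_integral (by positivity)]
  refine setIntegral_congr_fun measurableSet_Ioi fun x hx => ?_
  rw [add_sub_cancel_right, Real.rpow_natCast, abs_of_pos (Set.mem_Ioi.1 hx), mul_comm]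

/-- An operator with nonnegative expectation values in all product vectors `v ⊗ ⋯ ⊗ v` has a
nonnegative trace on the symmetric subspace. This holds because the average of
`|v⟩⟨v|^{⊗ n}` over a Gaussian vector `v` (components with independent uniform phases and
exponentially distributed squared moduli) is `n!` times the symmetric projector. -/
theorem trace_mul_symProj_re_nonneg {G : Matrix (Copies d n) (Copies d n) ℂ}
    (hG : ∀ v, 0 ≤ (G * tensorPowOp n v).trace.re) : 0 ≤ (G * symProj d n).trace.re := by
  have h1 : 0 ≤ ∫ x : Fin d → ℝ, ∑ i, ∑ j : Copies d n,
      (if occ j = occ i then (G i j).re else 0) * ∏ a, (|x a| ^ occ j a * Real.exp (-x a))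
      ∂(Measure.pi fun _ => volume.restrict (Set.Ioi 0)) := by
    refine integral_nonneg fun x => ?_
    simp only [Finset.prod_mul_distrib, ← mul_assoc, ← Finset.sum_mul]
    exact mul_nonneg (sum_occ_eq_nonneg hG fun a => abs_nonneg (x a))
      (Finset.prod_nonneg fun a _ => (Real.exp_pos _).le)
  have hint : ∀ (i j : Copies d n), Integrable (fun x : Fin d → ℝ =>
      (if occ j = occ i then (G i j).re else 0) * ∏ a, (|x a| ^ occ j a * Real.exp (-x a)))
      (Measure.pi fun _ => volume.restrict (Set.Ioi 0)) := fun i j =>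
    (Integrable.fintype_prod (f := fun a (x : ℝ) => |x| ^ occ j a * Real.exp (-x))
      fun a => integrable_abs_pow_mul_exp _).const_mul _
  rw [integral_finsetSum _ fun i _ => integrable_finsetSum _ fun j _ => hint i j] at h1
  have hmoment : ∀ j : Copies d n, ∫ x : Fin d → ℝ, ∏ a, (|x a| ^ occ j a * Real.exp (-x a))
      ∂(Measure.pi fun _ => volume.restrict (Set.Ioi 0)) = ∏ a, ((occ j a).factorial : ℝ) := by
    intro j
    rw [integral_fintype_prod_eq_prod fun a (x : ℝ) => |x| ^ occ j a * Real.exp (-x)]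
    exact Finset.prod_congr rfl fun a _ => integral_abs_pow_mul_exp _
  simp only [integral_finsetSum _ fun j _ => hint _ j, integral_const_mul, hmoment] at h1
  have h2 : (G * symProj d n).trace.re = (n.factorial : ℝ)⁻¹ * ∑ i, ∑ j : Copies d n,
      (if occ j = occ i then (G i j).re else 0) * ∏ a, ((occ j a).factorial : ℝ) := by
    simp only [Matrix.trace, Matrix.diag, Matrix.mul_apply, Complex.re_sum, Finset.mul_sum,
      symProj_apply_occ]
    refine Finset.sum_congr rfl fun i _ => Finset.sum_congr rfl fun j _ => ?_
    split_ifs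
    · rw [show (n.factorial : ℂ)⁻¹ * ∏ a, ((occ j a).factorial : ℂ)
        = (((n.factorial : ℝ)⁻¹ * ∏ a, ((occ j a).factorial : ℝ) : ℝ) : ℂ) by push_cast; rfl,
        Complex.re_mul_ofReal]
      ring
    · simp
  rw [h2]
  exact mul_nonneg (by positivity) h1

end Average

/-! ### Product states span the operators on the symmetric subspace -/

section Span

open MvPolynomial

variable {d n : ℕ}

/-- A polynomial in the components of a vector and their conjugates that vanishes identically
vanishes when the components and their conjugates are replaced by independent variables. -/
theorem sum_prod_eq_zero_of_star {c : Copies d n → Copies d n → ℂ}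
    (hc : ∀ v : Fin d → ℂ, ∑ i, ∑ j, c i j * ((∏ k, v (i k)) * star (∏ k, v (j k))) = 0)
    (u w : Fin d → ℂ) : ∑ i, ∑ j, c i j * ((∏ k, u (i k)) * ∏ k, w (j k)) = 0 := by
  -- the variables `inl a` and `inr a` stand for the real and the imaginary part of the component
  let p : MvPolynomial (Fin d ⊕ Fin d) ℂ := ∑ i : Copies d n, ∑ j : Copies d n, C (c i j) *
    ((∏ k, (X (Sum.inl (i k)) + C Complex.I * X (Sum.inr (i k)))) *
      ∏ k, (X (Sum.inl (j k)) - C Complex.I * X (Sum.inr (j k))))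
  have hp : p = 0 := by
    refine MvPolynomial.funext_set (fun _ => Set.range ((↑) : ℝ → ℂ))
      (fun _ => Set.infinite_range_of_injective Complex.ofReal_injective) fun x hx => ?_
    choose y hy using fun s => hx s (Set.mem_univ s)
    have := hc fun a => (y (Sum.inl a) : ℂ) + Complex.I * y (Sum.inr a)
    simp only [star_prod, star_add, star_mul', Complex.star_def, Complex.conj_ofReal,
      Complex.conj_I] at this
    simp only [p, map_sum, map_mul, map_prod, map_add, map_sub, eval_C, eval_X, ← hy, map_zero]
    rw [← this]
    simp only [neg_mul, ← sub_eq_add_neg]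
  have := congrArg (MvPolynomial.eval (Sum.elim (fun a => (u a + w a) / 2)
    fun a => (u a - w a) / (2 * Complex.I))) hp
  simp only [p, map_sum, map_mul, map_prod, map_add, map_sub, eval_C, eval_X, map_zero,
    Sum.elim_inl, Sum.elim_inr] at this
  have h1 : ∀ a, (u a + w a) / 2 + Complex.I * ((u a - w a) / (2 * Complex.I)) = u a := by
    intro a; field_simp [Complex.I_ne_zero]; ring
  have h2 : ∀ a, (u a + w a) / 2 - Complex.I * ((u a - w a) / (2 * Complex.I)) = w a := by
    intro a; field_simp [Complex.I_ne_zero]; ring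
  simpa only [h1, h2] using this

/-- Comparing coefficients: the terms of given occupation numbers add up to zero. -/
theorem sum_occ_eq_zero {c : Copies d n → Copies d n → ℂ}
    (hc : ∀ u w : Fin d → ℂ, ∑ i, ∑ j, c i j * ((∏ k, u (i k)) * ∏ k, w (j k)) = 0)
    (i₀ j₀ : Copies d n) :
    ∑ i, ∑ j, (if occ i = occ i₀ ∧ occ j = occ j₀ then c i j else 0) = 0 := by
  let e : Copies d n → Copies d n → (Fin d ⊕ Fin d) →₀ ℕ := fun i j =>
    Finsupp.equivFunOnFinite.symm (Sum.elim (occ i) (occ j))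
  have he : ∀ i j, e i j = e i₀ j₀ ↔ occ i = occ i₀ ∧ occ j = occ j₀ := by
    intro i j
    rw [Finsupp.equivFunOnFinite.symm.injective.eq_iff, Sum.elim_eq_iff]
  let q : MvPolynomial (Fin d ⊕ Fin d) ℂ := ∑ i : Copies d n, ∑ j : Copies d n,
    monomial (e i j) (c i j)
  have hq : q = 0 := by
    refine MvPolynomial.funext fun x => ?_
    rw [map_zero, ← hc (fun a => x (Sum.inl a)) fun a => x (Sum.inr a)]
    simp only [q, map_sum, eval_monomial]
    refine Finset.sum_congr rfl fun i _ => Finset.sum_congr rfl fun j _ => ?_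
    rw [Finsupp.prod_fintype _ _ (fun _ => pow_zero _), Fintype.prod_sum_type,
      prod_eq_prod_pow_occ (fun a => x (Sum.inl a)), prod_eq_prod_pow_occ (fun a => x (Sum.inr a))]
    rfl
  have := congrArg (coeff (e i₀ j₀)) hq
  simpa only [q, coeff_sum, coeff_monomial, he, coeff_zero] using this

/-- A linear functional that vanishes on all pure product states vanishes on all operators on the
symmetric subspace. -/
theorem functional_symProj_conj_eq_zero (hd : 0 < d)
    (f : Matrix (Copies d n) (Copies d n) ℂ →ₗ[ℂ] ℂ)
    (hf : ∀ ψ : PureState d, f (copiesState n ψ) = 0) (X : Matrix (Copies d n) (Copies d n) ℂ) :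
    f (symProj d n * X * symProj d n) = 0 := by
  let P := symProj d n
  let c : Copies d n → Copies d n → ℂ := fun i j => f (P * Matrix.single i j 1 * P)
  have hexp : ∀ X, f (P * X * P) = ∑ i, ∑ j, c i j * X i j := by
    intro X
    conv_lhs => rw [Matrix.matrix_eq_sum_single X]
    simp only [Matrix.mul_sum, Matrix.sum_mul, map_sum]
    refine Finset.sum_congr rfl fun i _ => Finset.sum_congr rfl fun j _ => ?_
    rw [show Matrix.single i j (X i j) = X i j • Matrix.single i j (1 : ℂ) by simp,
      Matrix.mul_smul, Matrix.smul_mul, map_smul, smul_eq_mul, mul_comm]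
  have hocc : ∀ i j i' j', occ i' = occ i → occ j' = occ j → c i' j' = c i j := by
    intro i j i' j' hi hj
    refine congrArg f (Matrix.ext fun k l => ?_)
    have hkl : ∀ i j, (P * Matrix.single i j (1 : ℂ) * P : Matrix _ _ ℂ) k l = P k i * P j l := by
      intro i j
      simp [Matrix.mul_apply, Matrix.single_apply, ite_and]
    refine (hkl _ _).trans (Eq.trans ?_ (hkl _ _).symm)
    simp only [P, symProj_apply_occ, hi, hj]
  have hzero := sum_prod_eq_zero_of_star (c := c) fun v => by
    obtain ⟨ψ, s, -, hs⟩ := exists_tensorPowOp_eq_smul hd n v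
    refine (hexp (tensorPowOp n v)).symm.trans ?_
    rw [symProj_mul_tensorPowOp, tensorPowOp_mul_symProj, hs, map_smul, hf, smul_zero]
  have hc0 : ∀ i j, c i j = 0 := by
    intro i₀ j₀
    have h := sum_occ_eq_zero hzero i₀ j₀
    have h1 : ∀ i j, (if occ i = occ i₀ ∧ occ j = occ j₀ then c i j else 0)
        = (if occ i = occ i₀ ∧ occ j = occ j₀ then 1 else 0) * c i₀ j₀ := by
      intro i j
      split_ifs with hij
      · rw [one_mul, hocc _ _ _ _ hij.1 hij.2]
      · rw [zero_mul]
    simp only [h1, ← Finset.sum_mul] at h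
    refine (mul_eq_zero.1 h).resolve_left ?_
    rw [← Fintype.sum_prod_type', Finset.sum_boole, Nat.cast_eq_zero, ← ne_eq, Finset.card_ne_zero]
    exact ⟨(i₀, j₀), by simp⟩
  rw [hexp X]
  simp [hc0]

/-- Linear maps that agree on all pure product states agree on all operators on the symmetric
subspace. -/
theorem eq_on_symProj_conj (hd : 0 < d) {B : Type}
    {Φ Ψ : Matrix (Copies d n) (Copies d n) ℂ →ₗ[ℂ] Matrix B B ℂ}
    (h : ∀ ψ : PureState d, Φ (copiesState n ψ) = Ψ (copiesState n ψ))
    (X : Matrix (Copies d n) (Copies d n) ℂ) :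
    Φ (symProj d n * X * symProj d n) = Ψ (symProj d n * X * symProj d n) := by
  ext b b'
  have := functional_symProj_conj_eq_zero hd
    (Matrix.entryLinearMap ℂ ℂ b b' ∘ₗ (Φ - Ψ)) (fun ψ => by simp [h]) X
  simpa [sub_eq_zero] using this

end Span

/-! ### Compactness of the set of quantum operations -/

section Compactness

variable {A B : Type} [Fintype A] [DecidableEq A] [Fintype B] [DecidableEq B]

theorem PosSemidef.norm_apply_le {Z : Matrix A A ℂ} (hZ : Z.PosSemidef) (i j : A) :
    ‖Z i j‖ ≤ (Z i i).re + (Z j j).re := by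
  obtain ⟨C, rfl⟩ := PosSemidef.eq_conjTranspose_mul_self hZ
  have hd : ∀ i, ((Cᴴ * C) i i).re = ∑ k, ‖C k i‖ ^ 2 := by
    intro i
    rw [Matrix.mul_apply, Complex.re_sum]
    refine Finset.sum_congr rfl fun k _ => ?_
    rw [conjTranspose_apply, Complex.star_def, ← Complex.normSq_eq_conj_mul_self,
      Complex.ofReal_re, Complex.normSq_eq_norm_sq]
  rw [hd, hd, Matrix.mul_apply, ← Finset.sum_add_distrib]
  refine norm_sum_le_of_le _ fun k _ => ?_
  rw [conjTranspose_apply, norm_mul, norm_star]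
  nlinarith [sq_nonneg (‖C k i‖ - ‖C k j‖), sq_nonneg ‖C k i‖, sq_nonneg ‖C k j‖]

theorem PosSemidef.apply_self_re_le_trace {Z : Matrix A A ℂ} (hZ : Z.PosSemidef) (i : A) :
    (Z i i).re ≤ Z.trace.re := by
  rw [Matrix.trace, Complex.re_sum]
  exact Finset.single_le_sum (f := fun i => (Z i i).re)
    (fun k _ => (Complex.le_def.1 hZ.diag_nonneg).1) (Finset.mem_univ i)

theorem isClosed_posSemidef : IsClosed {Z : Matrix A A ℂ | Z.PosSemidef} := by
  simp only [posSemidef_iff_dotProduct_mulVec, Set.ofPred_and, Set.ofPred_forall]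
  refine (isClosed_eq (by fun_prop) continuous_id).inter (isClosed_iInter fun x => ?_)
  exact isClosed_le continuous_const (by fun_prop)

/-- The linear map with matrix elements `c a a' b b'` of the image of `|a⟩⟨a'|`. -/
def ofCoeff (c : A → A → B → B → ℂ) : Matrix A A ℂ →ₗ[ℂ] Matrix B B ℂ where
  toFun X := Matrix.of fun b b' => ∑ a, ∑ a', X a a' * c a a' b b'
  map_add' X Y := by ext; simp [add_mul, Finset.sum_add_distrib]
  map_smul' s X := by ext; simp [Finset.mul_sum, mul_assoc]

theorem ofCoeff_apply (c : A → A → B → B → ℂ) (X : Matrix A A ℂ) (b b' : B) :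
    ofCoeff c X b b' = ∑ a, ∑ a', X a a' * c a a' b b' := rfl

theorem exists_ofCoeff_eq (Φ : Matrix A A ℂ →ₗ[ℂ] Matrix B B ℂ) : ∃ c, ofCoeff c = Φ := by
  refine ⟨fun a a' b b' => Φ (Matrix.single a a' 1) b b', LinearMap.ext fun X => ?_⟩
  ext b b'
  rw [ofCoeff_apply]
  conv_rhs => rw [Matrix.matrix_eq_sum_single X]
  simp only [map_sum, Matrix.sum_apply]
  refine Finset.sum_congr rfl fun a _ => Finset.sum_congr rfl fun a' _ => ?_
  rw [show Matrix.single a a' (X a a') = X a a' • Matrix.single a a' (1 : ℂ) by simp, map_smul,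
    Matrix.smul_apply, smul_eq_mul]

theorem ofCoeff_single (c : A → A → B → B → ℂ) (a a' : A) (b b' : B) :
    ofCoeff c (Matrix.single a a' 1) b b' = c a a' b b' := by
  simp [ofCoeff_apply, Matrix.single_apply, ite_and]

theorem continuous_ofCoeff_apply (X : Matrix A A ℂ) :
    Continuous fun c : A → A → B → B → ℂ => ofCoeff c X := by
  refine continuous_matrix fun b b' => ?_
  simp only [ofCoeff_apply]
  fun_prop

/-- The matrix elements of a quantum operation are bounded. The `(a, a')` block of matrix elements
occurs, with the two diagonal blocks, in the image of a positive operator of rank one on the system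
extended by a two-dimensional reference. -/
theorem norm_coeff_le {c : A → A → B → B → ℂ} (hc : IsQuantumOperation (ofCoeff c))
    (a a' : A) (b b' : B) : ‖c a a' b b'‖ ≤ 2 := by
  let f : Fin 2 → A := ![a, a']
  let v : A × Fin 2 → ℂ := fun p => if p.1 = f p.2 then 1 else 0
  have hpos := hc.1 2 _ (posSemidef_vecMulVec_self_star v)
  have hentry : ∀ (s t : Fin 2) (x y : B),
      ampliation (ofCoeff c) 2 (vecMulVec v (star v)) (x, s) (y, t)
      = c (f s) (f t) x y := by
    intro s t x y
    rw [← ofCoeff_single c]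
    refine congrFun (congrFun (congrArg (ofCoeff c) (Matrix.ext fun p q => ?_)) x) y
    simp only [of_apply, vecMulVec_apply, v, Pi.star_apply, Matrix.single_apply]
    by_cases hp : p = f s <;> by_cases hq : q = f t <;> simp [hp, hq, eq_comm]
  have hdiag : ∀ (s : Fin 2) (x : B), (c (f s) (f s) x x).re ≤ 1 := by
    intro s x
    have hdens : IsDensity (Matrix.single (f s) (f s) (1 : ℂ)) := by
      refine ⟨?_, by simp⟩
      have := posSemidef_vecMulVec_self_star (Pi.single (f s) (1 : ℂ))
      convert this using 1
      ext p q
      by_cases hp : p = f s <;> by_cases hq : q = f s <;>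
        simp [vecMulVec_apply, hp, hq, eq_comm]
    rw [← ofCoeff_single c]
    exact (PosSemidef.apply_self_re_le_trace (hc.1.posSemidef hdens.1) x).trans (hc.2 _ hdens)
  have h := PosSemidef.norm_apply_le hpos (b, 0) (b', 1)
  rw [hentry, hentry, hentry] at h
  calc ‖c a a' b b'‖ ≤ _ := h
    _ ≤ 1 + 1 := add_le_add (hdiag 0 b) (hdiag 1 b')
    _ = 2 := by norm_num

theorem isClosed_isCompletelyPositive :
    IsClosed {c : A → A → B → B → ℂ | IsCompletelyPositive (ofCoeff c)} := by
  simp only [IsCompletelyPositive, Set.ofPred_forall]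
  refine isClosed_iInter fun k => isClosed_iInter fun M => isClosed_iInter fun _ => ?_
  refine isClosed_posSemidef.preimage (f := fun c => ampliation (ofCoeff c) k M)
    (continuous_matrix fun p q => ?_)
  simp only [ampliation, of_apply, ofCoeff_apply]
  fun_prop

theorem isCompact_isQuantumOperation :
    IsCompact {c : A → A → B → B → ℂ | IsQuantumOperation (ofCoeff c)} := by
  refine Metric.isCompact_of_isClosed_isBounded ?_ ?_
  · simp only [IsQuantumOperation, Set.ofPred_and, Set.ofPred_forall]
    refine isClosed_isCompletelyPositive.inter (isClosed_iInter fun ρ =>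
      isClosed_iInter fun _ => ?_)
    exact isClosed_le (Complex.continuous_re.comp (continuous_ofCoeff_apply ρ).matrix_trace)
      continuous_const
  · refine (Metric.isBounded_closedBall (x := 0) (r := 2)).subset fun c hc => ?_
    rw [mem_closedBall_zero_iff]
    simp only [pi_norm_le_iff_of_nonneg (zero_le_two (α := ℝ))]
    exact fun a a' b b' => norm_coeff_le hc a a' b b'

/-- A positive matrix is at most its operator norm times the identity. -/
theorem exists_smul_one_sub_posSemidef {Z : Matrix A A ℂ} (hZ : Z.PosSemidef) :
    ∃ s : ℝ, 0 ≤ s ∧ (s • (1 : Matrix A A ℂ) - Z).PosSemidef := by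
  open scoped MatrixOrder Matrix.Norms.L2Operator in
  have h := IsSelfAdjoint.le_algebraMap_norm_self (a := Z) hZ.1
  rw [Matrix.le_iff, Algebra.algebraMap_eq_smul_one] at h
  exact ⟨_, norm_nonneg Z, h⟩

theorem gibbsProb_pos [Nonempty A] (β : ℝ) (ε : A → ℝ) (a : A) : 0 < gibbsProb β ε a :=
  div_pos (Real.exp_pos _) (Finset.sum_pos (fun _ _ => Real.exp_pos _) Finset.univ_nonempty)

/-- The infimum that defines the nonequilibrium cost is attained as soon as the factors `2 ^ l` are
bounded away from zero. -/
theorem isLeast_channelCost [Nonempty B] {β : ℝ} {εA : A → ℝ} {εB : B → ℝ} {P : Matrix A A ℂ}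
    {M : Matrix A A ℂ →ₗ[ℂ] Matrix B B ℂ} (hM : IsQuantumOperation M)
    (hpos : ∃ s : ℝ, 0 < s ∧ ∀ l ∈ costExponents β εA εB P M, s ≤ (2 : ℝ) ^ l)
    (hA : (gibbs β εA).PosSemidef) :
    IsLeast (costExponents β εA εB P M) (channelCost β εA εB P M) := by
  obtain ⟨s₁, hs₁, hlow⟩ := hpos
  have hpow : ∀ s : ℝ, 0 < s → (2 : ℝ) ^ Real.logb 2 s = s := fun s hs =>
    Real.rpow_logb (by norm_num) (by norm_num) hs
  obtain ⟨b₀, hb₀⟩ := Finite.exists_min (gibbsProb β εB)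
  obtain ⟨z, hz0, hz⟩ := exists_smul_one_sub_posSemidef (hM.1.posSemidef hA)
  have hδ := gibbsProb_pos β εB b₀
  -- a factor for which `M` itself is admissible
  set u : ℝ := z / gibbsProb β εB b₀ + 1 with hu
  have hu0 : 0 < u := by positivity
  have hmem : (u • gibbs β εB - M (gibbs β εA)).PosSemidef := by
    have h1 : (u • gibbs β εB - z • (1 : Matrix B B ℂ)).PosSemidef := by
      rw [gibbs, ← diagonal_one, ← diagonal_smul, ← diagonal_smul, diagonal_sub,
        posSemidef_diagonal_iff]
      intro b
      have : z ≤ u * gibbsProb β εB b := by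
        calc z = z / gibbsProb β εB b₀ * gibbsProb β εB b₀ := by field_simp
          _ ≤ u * gibbsProb β εB b :=
            mul_le_mul (by linarith) (hb₀ b) hδ.le hu0.le
      have h2 : (0 : ℂ) ≤ ((u * gibbsProb β εB b - z : ℝ) : ℂ) := by
        exact_mod_cast sub_nonneg.2 this
      simpa using h2
    have := h1.add hz
    rwa [sub_add_sub_cancel] at this
  -- admissible operations together with their factors, which are confined to a compact interval
  let S : Set ((A → A → B → B → ℂ) × ℝ) :=
    ({c | IsQuantumOperation (ofCoeff c)} ×ˢ Set.Icc s₁ u) ∩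
      ({x | ∀ ρ, IsDensity ρ → ofCoeff x.1 (P * ρ * P) = M (P * ρ * P)} ∩
        {x | (x.2 • gibbs β εB - ofCoeff x.1 (gibbs β εA)).PosSemidef})
  have hS : IsCompact S := by
    refine (isCompact_isQuantumOperation.prod isCompact_Icc).inter_right (IsClosed.inter ?_ ?_)
    · simp only [Set.ofPred_forall]
      exact isClosed_iInter fun ρ => isClosed_iInter fun _ =>
        isClosed_eq ((continuous_ofCoeff_apply _).comp continuous_fst) continuous_const
    · exact isClosed_posSemidef.preimage ((continuous_snd.smul continuous_const).sub
        ((continuous_ofCoeff_apply _).comp continuous_fst))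
  have hmemS : ∀ l ∈ costExponents β εA εB P M, (2 : ℝ) ^ l ≤ u → ∃ x ∈ S, x.2 = (2 : ℝ) ^ l := by
    rintro l hl hlu
    obtain ⟨M', hM', hagree, hle⟩ := id hl
    obtain ⟨c, rfl⟩ := exists_ofCoeff_eq M'
    exact ⟨(c, (2 : ℝ) ^ l), ⟨⟨hM', hlow l hl, hlu⟩, hagree, hle⟩, rfl⟩
  have hmu : Real.logb 2 u ∈ costExponents β εA εB P M :=
    ⟨M, hM, fun _ _ => rfl, by rwa [hpow u hu0]⟩
  obtain ⟨x₀, hx₀, -⟩ := hmemS _ hmu (hpow u hu0).le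
  obtain ⟨x, hx, hmin⟩ := hS.exists_isMinOn ⟨x₀, hx₀⟩ continuous_snd.continuousOn
  have hxpos : 0 < x.2 := hs₁.trans_le hx.1.2.1
  have hleast : IsLeast (costExponents β εA εB P M) (Real.logb 2 x.2) := by
    refine ⟨⟨ofCoeff x.1, hx.1.1, hx.2.1, ?_⟩, fun l hl => ?_⟩
    · rw [hpow _ hxpos]
      exact hx.2.2
    · rw [Real.logb_le_iff_le_rpow (by norm_num) hxpos]
      rcases le_total ((2 : ℝ) ^ l) u with h | h
      · obtain ⟨y, hy, hyl⟩ := hmemS l hl h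
        rw [← hyl]
        exact hmin hy
      · exact hx.1.2.2.trans h
  rw [channelCost, hleast.csInf_eq]
  exact hleast

end Compactness

/-! ### Gibbs states of several copies -/

section Thermal

variable {d N m : ℕ}

theorem gibbsProb_copiesEnergy (β : ℝ) (E : Fin d → ℝ) (n : ℕ) (i : Copies d n) :
    gibbsProb β (copiesEnergy E n) i = ∏ k, gibbsProb β E (i k) := by
  have h : ∀ i : Copies d n, Real.exp (-β * copiesEnergy E n i) = ∏ k, Real.exp (-β * E (i k)) := by
    intro i
    rw [copiesEnergy, Finset.mul_sum, Real.exp_sum]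
  have hZ : partitionFunction β (copiesEnergy E n) = partitionFunction β E ^ n := by
    rw [partitionFunction, partitionFunction, Fintype.sum_pow]
    exact Finset.sum_congr rfl fun i _ => h i
  rw [gibbsProb, h, hZ]
  simp [gibbsProb, Finset.prod_div_distrib]

theorem sum_gibbsProb {A : Type} [Fintype A] [Nonempty A] (β : ℝ) (ε : A → ℝ) :
    ∑ a, gibbsProb β ε a = 1 := by
  unfold gibbsProb
  rw [← Finset.sum_div]
  exact div_self (Finset.sum_pos (fun _ _ => Real.exp_pos _) Finset.univ_nonempty).ne'

theorem gibbs_posSemidef {A : Type} [Fintype A] [DecidableEq A] [Nonempty A] (β : ℝ) (ε : A → ℝ) :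
    (gibbs β ε).PosSemidef :=
  PosSemidef.diagonal fun a => by
    simpa using (gibbsProb_pos β ε a).le

theorem gibbs_isDensity {A : Type} [Fintype A] [DecidableEq A] [Nonempty A] (β : ℝ) (ε : A → ℝ) :
    IsDensity (gibbs β ε) := by
  refine ⟨gibbs_posSemidef β ε, ?_⟩
  rw [gibbs, trace_diagonal, ← Complex.ofReal_sum, sum_gibbsProb, Complex.ofReal_one]

theorem gibbsPow_mul_single_mul {A : Type} [Fintype A] [DecidableEq A] (β : ℝ) (ε : A → ℝ) (s : ℝ)
    (a : A) : gibbsPow β ε s * Matrix.single a a 1 * gibbsPow β ε s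
      = (((gibbsProb β ε a ^ s) ^ 2 : ℝ) : ℂ) • Matrix.single a a (1 : ℂ) := by
  ext i j
  rw [gibbsPow, Matrix.mul_diagonal, Matrix.diagonal_mul, Matrix.smul_apply, Matrix.single_apply]
  split_ifs with h
  · rw [← h.1, ← h.2]; push_cast; simp [sq]
  · simp

theorem gibbsPow_mul_tensorPowOp_mul (hd : 0 < d) (β : ℝ) (E : Fin d → ℝ) (s : ℝ) (n : ℕ)
    (v : Fin d → ℂ) :
    gibbsPow β (copiesEnergy E n) s * tensorPowOp n v * gibbsPow β (copiesEnergy E n) s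
      = tensorPowOp n fun a => ((gibbsProb β E a ^ s : ℝ) : ℂ) * v a := by
  have : Nonempty (Fin d) := ⟨⟨0, hd⟩⟩
  have h : ∀ i : Copies d n, ((gibbsProb β (copiesEnergy E n) i ^ s : ℝ) : ℂ)
      = ∏ k, ((gibbsProb β E (i k) ^ s : ℝ) : ℂ) := by
    intro i
    rw [gibbsProb_copiesEnergy, ← Real.finsetProd_rpow _ _ fun k _ => (gibbsProb_pos β E _).le]
    push_cast; rfl
  ext i j
  rw [gibbsPow, Matrix.mul_diagonal, Matrix.diagonal_mul, tensorPowOp_apply, tensorPowOp_apply,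
    h, h, Finset.prod_mul_distrib, Finset.prod_mul_distrib, star_mul', star_prod, star_prod]
  simp only [Complex.star_def, Complex.conj_ofReal]
  ring

theorem symProj_mul_gibbs (β : ℝ) (E : Fin d → ℝ) (n : ℕ) :
    symProj d n * gibbs β (copiesEnergy E n) = gibbs β (copiesEnergy E n) * symProj d n :=
  symProj_mul_diagonal fun σ i => by
    rw [gibbsProb_copiesEnergy, gibbsProb_copiesEnergy,
      Equiv.prod_comp σ fun k => gibbsProb β E (i k)]

/-- Compressing the Gibbs state to the symmetric subspace makes it smaller, because the two
commute. -/
theorem gibbs_sub_symProj_conj_posSemidef (hd : 0 < d) (β : ℝ) (E : Fin d → ℝ) (n : ℕ) :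
    (gibbs β (copiesEnergy E n)
      - symProj d n * gibbs β (copiesEnergy E n) * symProj d n).PosSemidef := by
  have : Nonempty (Copies d n) := ⟨fun _ => ⟨0, hd⟩⟩
  have h := (gibbs_posSemidef β (copiesEnergy E n)).mul_mul_conjTranspose_same (1 - symProj d n)
  rw [conjTranspose_sub, conjTranspose_one, symProj_isHermitian] at h
  convert h using 1
  rw [Matrix.sub_mul, Matrix.one_mul, Matrix.mul_sub, Matrix.mul_one, Matrix.sub_mul,
    symProj_mul_gibbs, Matrix.mul_assoc, symProj_mul_self]
  abel

theorem trace_symProj_conj (n : ℕ) (X : Matrix (Copies d n) (Copies d n) ℂ) :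
    (symProj d n * X * symProj d n).trace = (symProj d n * X).trace := by
  rw [Matrix.trace_mul_comm, ← Matrix.mul_assoc, symProj_mul_self]

/-- The weight `Tr[P Γ]` of the symmetric subspace in the Gibbs state of `n` copies. -/
noncomputable def symWeight (β : ℝ) (E : Fin d → ℝ) (n : ℕ) : ℝ :=
  (symProj d n * gibbs β (copiesEnergy E n)).trace.re

theorem trace_symProj_mul_gibbs (hd : 0 < d) (β : ℝ) (E : Fin d → ℝ) (n : ℕ) :
    (symProj d n * gibbs β (copiesEnergy E n)).trace = (symWeight β E n : ℂ) := by
  have : Nonempty (Copies d n) := ⟨fun _ => ⟨0, hd⟩⟩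
  have h := (gibbs_posSemidef β (copiesEnergy E n)).mul_mul_conjTranspose_same (symProj d n)
  rw [symProj_isHermitian] at h
  refine Complex.ext rfl ?_
  rw [← trace_symProj_conj]
  simpa using (Complex.le_def.1 h.trace_nonneg).2.symm

theorem trace_copiesState_basisState_mul (n : ℕ) (x : Fin d)
    (Y : Matrix (Copies d n) (Copies d n) ℂ) :
    (copiesState n (basisState x) * Y).trace = Y (fun _ => x) fun _ => x := by
  rw [copiesState_basisState, Matrix.trace_mul_comm, Matrix.trace_mul_single]
  simp

theorem gibbs_sub_basisState_posSemidef (hd : 0 < d) (β : ℝ) (E : Fin d → ℝ) (n : ℕ) (x : Fin d) :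
    (gibbs β (copiesEnergy E n)
      - (gibbsProb β E x ^ n) • copiesState n (basisState x)).PosSemidef := by
  have : Nonempty (Copies d n) := ⟨fun _ => ⟨0, hd⟩⟩
  have h : gibbs β (copiesEnergy E n) - (gibbsProb β E x ^ n) • copiesState n (basisState x)
      = Matrix.diagonal fun i => if (fun _ => x) = i then 0
          else ((gibbsProb β (copiesEnergy E n) i : ℝ) : ℂ) := by
    ext i j
    rw [copiesState_basisState, Matrix.sub_apply, Matrix.smul_apply, gibbs, Matrix.diagonal_apply,
      Matrix.diagonal_apply, Matrix.single_apply]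
    by_cases hij : i = j
    · subst hij
      by_cases hi : (fun _ => x) = i
      · subst hi
        simp [gibbsProb_copiesEnergy]
      · simp [hi]
    · rw [if_neg hij, if_neg hij, if_neg (fun h => hij (h.1.symm.trans h.2)), smul_zero, sub_zero]
  rw [h]
  refine PosSemidef.diagonal fun i => ?_
  by_cases hi : (fun _ => x) = i
  · simp [hi]
  · simpa [hi] using (gibbsProb_pos β (copiesEnergy E n) i).le

theorem symWeight_pos (hd : 0 < d) (β : ℝ) (E : Fin d → ℝ) (n : ℕ) : 0 < symWeight β E n := by
  have : Nonempty (Fin d) := ⟨⟨0, hd⟩⟩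
  let x : Fin d := ⟨0, hd⟩
  have h := PosSemidef.trace_mul_re_nonneg (symProj_posSemidef (d := d) (n := n))
    (gibbs_sub_basisState_posSemidef hd β E n x)
  rw [Matrix.mul_sub, trace_sub, Complex.sub_re, Matrix.mul_smul, trace_smul, copiesState_eq,
    symProj_mul_tensorPowOp, ← copiesState_eq, (copiesState_isDensity _).2, Complex.real_smul,
    mul_one, Complex.ofReal_re] at h
  exact (pow_pos (gibbsProb_pos β E x) n).trans_le (sub_nonneg.1 h)

theorem attach_gibbs (β : ℝ) (E : Fin d → ℝ) :
    attach (gibbsProb β (copiesEnergy E m)) (gibbs β (copiesEnergy E N))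
      = gibbs β (copiesEnergy E (N + m)) := by
  rw [gibbs, attach_diagonal, gibbs]
  congr 1
  funext i
  simp only [gibbsProb_copiesEnergy, prod_copies_add (gibbsProb β E)]
  push_cast; rfl

theorem attach_one_gibbs_le (hd : 0 < d) (β : ℝ) (E : Fin d → ℝ) {x : Fin d}
    (hx : ∀ a, gibbsProb β E x ≤ gibbsProb β E a) :
    ((gibbsProb β E x ^ m)⁻¹ • gibbs β (copiesEnergy E (N + m))
      - attach 1 (gibbs β (copiesEnergy E N))).PosSemidef := by
  have : Nonempty (Fin d) := ⟨⟨0, hd⟩⟩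
  rw [gibbs, gibbs, attach_diagonal, ← diagonal_smul, diagonal_sub]
  refine PosSemidef.diagonal fun i => ?_
  have hp := gibbsProb_pos β E
  have h1 : gibbsProb β E x ^ m ≤ ∏ k, gibbsProb β E (lastCopies i k) := by
    have := Finset.prod_le_prod (s := (Finset.univ : Finset (Fin m))) (fun k _ => (hp x).le)
      fun k _ => hx (lastCopies i k)
    simpa using this
  have h2 : (0 : ℝ) ≤ (gibbsProb β E x ^ m)⁻¹ * gibbsProb β (copiesEnergy E (N + m)) i
      - gibbsProb β (copiesEnergy E N) (firstCopies i) := by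
    have h0 := pow_pos (hp x) m
    have h3 : 0 ≤ ∏ k, gibbsProb β E (firstCopies i k) := Finset.prod_nonneg fun k _ => (hp _).le
    rw [gibbsProb_copiesEnergy, gibbsProb_copiesEnergy, prod_copies_add, sub_nonneg,
      le_inv_mul_iff₀ h0, mul_comm]
    exact mul_le_mul_of_nonneg_left h1 h3
  have h4 : (0 : ℂ) ≤ (((gibbsProb β E x ^ m)⁻¹ * gibbsProb β (copiesEnergy E (N + m)) i
      - gibbsProb β (copiesEnergy E N) (firstCopies i) : ℝ) : ℂ) := by
    exact_mod_cast h2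
  simpa using h4

end Thermal

/-! ### Trade-off between cost and accuracy -/

section Tradeoff

variable {d N m : ℕ}

theorem accuracy_le_trace {kT : ℝ} {E : Fin d → ℝ} {N' : ℕ}
    {M : Matrix (Copies d N) (Copies d N) ℂ →ₗ[ℂ] Matrix (Copies d N') (Copies d N') ℂ}
    (hM : IsChannel M) (ψ : PureState d) :
    (quantumCloning kT E N N').accuracy M ≤ (copiesState N' ψ * M (copiesState N ψ)).trace.re :=
  ciInf_le ⟨0, by
    rintro _ ⟨φ, rfl⟩
    exact PosSemidef.trace_mul_re_nonneg (tensorPowOp_posSemidef _)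
      (hM.1.posSemidef (tensorPowOp_posSemidef _))⟩ ψ

theorem le_accuracy (hd : 0 < d) {kT : ℝ} {E : Fin d → ℝ} {N' : ℕ}
    {M : Matrix (Copies d N) (Copies d N) ℂ →ₗ[ℂ] Matrix (Copies d N') (Copies d N') ℂ} {F : ℝ}
    (h : ∀ ψ, F ≤ (copiesState N' ψ * M (copiesState N ψ)).trace.re) :
    F ≤ (quantumCloning kT E N N').accuracy M := by
  have : Nonempty (PureState d) := ⟨basisState ⟨0, hd⟩⟩
  exact le_ciInf h

theorem symProj_conj_copiesState (ψ : PureState d) :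
    symProj d N * copiesState N ψ * symProj d N = copiesState N ψ := by
  rw [copiesState_eq, symProj_mul_tensorPowOp, tensorPowOp_mul_symProj]

/-- A quantum operation that acts as `M` on the symmetric subspace acts as `M` on product states. -/
theorem agree_copiesState {B : Type}
    {M M' : Matrix (Copies d N) (Copies d N) ℂ →ₗ[ℂ] Matrix B B ℂ}
    (h : ∀ ρ, IsDensity ρ → M' (symProj d N * ρ * symProj d N) = M (symProj d N * ρ * symProj d N))
    (ψ : PureState d) : M' (copiesState N ψ) = M (copiesState N ψ) := by
  simpa only [symProj_conj_copiesState] using h _ (copiesState_isDensity ψ)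

/-- Every factor `2 ^ l` is at least the thermal weight of the symmetric subspace, on which the
quantum operation preserves the trace. -/
theorem symWeight_le_of_mem_costExponents (hd : 0 < d) {β : ℝ} {E : Fin d → ℝ} {N' : ℕ}
    {M : Matrix (Copies d N) (Copies d N) ℂ →ₗ[ℂ] Matrix (Copies d N') (Copies d N') ℂ}
    (hM : IsChannel M) {l : ℝ}
    (hl : l ∈ costExponents β (copiesEnergy E N) (copiesEnergy E N') (symProj d N) M) :
    symWeight β E N ≤ (2 : ℝ) ^ l := by
  have : Nonempty (Copies d N) := ⟨fun _ => ⟨0, hd⟩⟩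
  have : Nonempty (Copies d N') := ⟨fun _ => ⟨0, hd⟩⟩
  obtain ⟨M', hM', hagree, hle⟩ := hl
  have h1 := PosSemidef.trace_re_nonneg hle
  have h2 := PosSemidef.trace_re_nonneg
    (hM'.1.posSemidef (gibbs_sub_symProj_conj_posSemidef hd β E N))
  rw [trace_sub, trace_smul, (gibbs_isDensity β _).2, Complex.sub_re, Complex.real_smul, mul_one,
    Complex.ofReal_re] at h1
  rw [map_sub, trace_sub, hagree _ (gibbs_isDensity β _), hM.2, trace_symProj_conj,
    Complex.sub_re] at h2
  have h3 : symWeight β E N = (symProj d N * gibbs β (copiesEnergy E N)).trace.re := rfl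
  linarith

/-- The accuracy for an energy eigenstate bounds the cost from below, because the Gibbs state
contains the product of eigenstates with its thermal weight. -/
theorem accuracy_le_of_mem_costExponents (hd : 0 < d) {β kT : ℝ} {E : Fin d → ℝ}
    {M : Matrix (Copies d N) (Copies d N) ℂ →ₗ[ℂ] Matrix (Copies d (N + m)) (Copies d (N + m)) ℂ}
    (hM : IsChannel M) {l : ℝ}
    (hl : l ∈ costExponents β (copiesEnergy E N) (copiesEnergy E (N + m)) (symProj d N) M)
    (x : Fin d) :
    (quantumCloning kT E N (N + m)).accuracy M ≤ (2 : ℝ) ^ l * gibbsProb β E x ^ m := by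
  have : Nonempty (Fin d) := ⟨x⟩
  obtain ⟨M', hM', hagree, hle⟩ := hl
  have hO := tensorPowOp_posSemidef (n := N + m) (basisState x).1
  rw [← copiesState_eq] at hO
  have h1 := PosSemidef.trace_mul_re_nonneg hO hle
  have h2 := PosSemidef.trace_mul_re_nonneg hO
    (hM'.1.posSemidef (gibbs_sub_basisState_posSemidef hd β E N x))
  have hΓ : (copiesState (N + m) (basisState x) * gibbs β (copiesEnergy E (N + m))).trace.re
      = gibbsProb β E x ^ (N + m) := by
    rw [trace_copiesState_basisState_mul, gibbs, diagonal_apply_eq, Complex.ofReal_re,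
      gibbsProb_copiesEnergy]
    simp
  rw [Matrix.mul_sub, trace_sub, Matrix.mul_smul, trace_smul, Complex.sub_re, Complex.real_smul,
    Complex.re_ofReal_mul, hΓ] at h1
  have hs : M' (gibbsProb β E x ^ N • copiesState N (basisState x))
      = gibbsProb β E x ^ N • M (copiesState N (basisState x)) := by
    rw [← agree_copiesState hagree, ← Complex.coe_smul, map_smul, Complex.coe_smul]
  rw [map_sub, hs, Matrix.mul_sub, trace_sub, Matrix.mul_smul, trace_smul, Complex.sub_re,
    Complex.real_smul, Complex.re_ofReal_mul] at h2
  have hp := pow_pos (gibbsProb_pos β E x) N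
  have h3 := accuracy_le_trace (kT := kT) (E := E) hM (basisState x)
  refine h3.trans (le_of_mul_le_mul_left ?_ hp)
  rw [pow_add] at h1
  linarith

theorem isLeast_cost (hd : 0 < d) (kT : ℝ) (E : Fin d → ℝ) {N' : ℕ}
    {M : Matrix (Copies d N) (Copies d N) ℂ →ₗ[ℂ] Matrix (Copies d N') (Copies d N') ℂ}
    (hM : IsChannel M) :
    IsLeast (costExponents (1 / kT) (copiesEnergy E N) (copiesEnergy E N') (symProj d N) M)
      ((quantumCloning kT E N N').cost M) := by
  have : Nonempty (Copies d N) := ⟨fun _ => ⟨0, hd⟩⟩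
  have : Nonempty (Copies d N') := ⟨fun _ => ⟨0, hd⟩⟩
  exact isLeast_channelCost hM.isQuantumOperation
    ⟨_, symWeight_pos hd _ E N, fun l hl => symWeight_le_of_mem_costExponents hd hM hl⟩
    (gibbs_posSemidef _ _)

theorem rpow_cost_le (hd : 0 < d) {kT : ℝ} {E : Fin d → ℝ} {N' : ℕ}
    {M M' : Matrix (Copies d N) (Copies d N) ℂ →ₗ[ℂ] Matrix (Copies d N') (Copies d N') ℂ}
    (hM : IsChannel M) (hM' : IsQuantumOperation M')
    (hagree : ∀ ρ, IsDensity ρ →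
      M' (symProj d N * ρ * symProj d N) = M (symProj d N * ρ * symProj d N))
    {s : ℝ} (hs : 0 < s) (hle : (s • gibbs (1 / kT) (copiesEnergy E N')
      - M' (gibbs (1 / kT) (copiesEnergy E N))).PosSemidef) :
    (2 : ℝ) ^ (quantumCloning kT E N N').cost M ≤ s := by
  have h2 : (2 : ℝ) ^ Real.logb 2 s = s := Real.rpow_logb (by norm_num) (by norm_num) hs
  have h : (quantumCloning kT E N N').cost M ≤ Real.logb 2 s :=
    (isLeast_cost hd kT E hM).2 ⟨M', hM', hagree, by rwa [h2]⟩
  calc (2 : ℝ) ^ (quantumCloning kT E N N').cost M ≤ (2 : ℝ) ^ Real.logb 2 s :=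
        Real.rpow_le_rpow_of_exponent_le (by norm_num) h
    _ = s := h2

/-- The accuracy of universal cloning is bounded by `d_N / d_{N'}`: as `ψ^{⊗ N} ≤ P_N`, the
accuracy is at most the expectation value of `ψ^{⊗ N'}` in `M P_N`, and the average of `ψ^{⊗ N'}`
is the normalized symmetric projector. -/
theorem accuracy_le_symDim_div (hd : 0 < d) {kT : ℝ} {E : Fin d → ℝ} {N' : ℕ}
    {M : Matrix (Copies d N) (Copies d N) ℂ →ₗ[ℂ] Matrix (Copies d N') (Copies d N') ℂ}
    (hM : IsChannel M) :
    (quantumCloning kT E N N').accuracy M ≤ symDim d N / symDim d N' := by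
  set F := (quantumCloning kT E N N').accuracy M with hF
  set Y := M (symProj d N) with hY
  have hproj : ∀ ψ : PureState d, (symProj d N - copiesState N ψ).PosSemidef := by
    intro ψ
    have hidem : copiesState N ψ * copiesState N ψ = copiesState N ψ := by
      have h1 : star (tensorPow N ψ.1) ⬝ᵥ tensorPow N ψ.1 = 1 := by
        have := (copiesState_isDensity (n := N) ψ).2
        rwa [copiesState_eq, tensorPowOp, trace_vecMulVec, dotProduct_comm] at this
      rw [copiesState_eq, tensorPowOp, vecMulVec_mul_vecMulVec, h1, one_smul]
    have hP : symProj d N * copiesState N ψ = copiesState N ψ := symProj_mul_tensorPowOp _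
    have hP' : copiesState N ψ * symProj d N = copiesState N ψ := tensorPowOp_mul_symProj _
    have h := posSemidef_conjTranspose_mul_self (symProj d N - copiesState N ψ)
    rwa [conjTranspose_sub, symProj_isHermitian, copiesState_eq, tensorPowOp_conjTranspose,
      ← copiesState_eq, Matrix.mul_sub, Matrix.sub_mul, Matrix.sub_mul, symProj_mul_self, hidem,
      hP, hP', sub_self, sub_zero] at h
  have hpure : ∀ ψ : PureState d, F ≤ (Y * copiesState N' ψ).trace.re := by
    intro ψ
    have h1 := PosSemidef.trace_mul_re_nonneg (tensorPowOp_posSemidef (n := N') ψ.1)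
      (hM.1.posSemidef (hproj ψ))
    rw [← copiesState_eq, map_sub, Matrix.mul_sub, trace_sub, Complex.sub_re] at h1
    rw [Matrix.trace_mul_comm]
    have h2 := accuracy_le_trace (kT := kT) (E := E) hM ψ
    linarith
  have hG := trace_mul_symProj_re_nonneg (d := d) (n := N') (G := Y - F • 1) fun v => by
    obtain ⟨ψ, c, hc, hv⟩ := exists_tensorPowOp_eq_smul hd N' v
    rw [hv, Matrix.mul_smul, trace_smul, smul_eq_mul, Complex.re_ofReal_mul, Matrix.sub_mul,
      trace_sub, Matrix.smul_mul, Matrix.one_mul, trace_smul, (copiesState_isDensity ψ).2,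
      Complex.sub_re, Complex.real_smul, mul_one, Complex.ofReal_re]
    exact mul_nonneg hc (sub_nonneg.2 (hpure ψ))
  have hle : (Y * symProj d N').trace.re ≤ symDim d N := by
    have h := PosSemidef.trace_mul_re_nonneg
      (hM.1.posSemidef (symProj_posSemidef (d := d) (n := N)))
      (one_sub_symProj_posSemidef (d := d) (n := N'))
    rw [Matrix.mul_sub, Matrix.mul_one, trace_sub, Complex.sub_re, hM.2, trace_symProj,
      Complex.ofReal_re, ← hY] at h
    linarith
  rw [Matrix.sub_mul, trace_sub, Matrix.smul_mul, Matrix.one_mul, trace_smul, trace_symProj,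
    Complex.sub_re, Complex.real_smul, Complex.re_ofReal_mul, Complex.ofReal_re] at hG
  rw [le_div_iff₀ (symDim_pos hd)]
  linarith

/-! ### Optimal operations -/

/-- The quantum operation `X ↦ (d_N / d_{N'}) P_{N'} (X ⊗ I) P_{N'}`, which acts as the optimal
universal cloner on the symmetric subspace. -/
noncomputable def cloningOperation (d N m : ℕ) : Matrix (Copies d N) (Copies d N) ℂ →ₗ[ℂ]
    Matrix (Copies d (N + m)) (Copies d (N + m)) ℂ :=
  (symDim d N / symDim d (N + m)) • (conjBy (symProj d (N + m)) ∘ₗ attach 1)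

theorem cloningOperation_apply (X : Matrix (Copies d N) (Copies d N) ℂ) :
    cloningOperation d N m X = (symDim d N / symDim d (N + m)) •
      (symProj d (N + m) * attach 1 X * symProj d (N + m)) := by
  simp [cloningOperation, conjBy_apply, symProj_isHermitian]

/-- The quantum operation of smallest cost with the largest accuracy. It maps the Gibbs state
`Γ_A` to `q Γ_B`, where `q = Tr[P Γ_A]`: with weight `q` it adds copies in the Gibbs state, and it
prepares what is then missing from `q Γ_B`. -/
noncomputable def thermalOperation (d N m : ℕ) (β : ℝ) (E : Fin d → ℝ) :
    Matrix (Copies d N) (Copies d N) ℂ →ₗ[ℂ] Matrix (Copies d (N + m)) (Copies d (N + m)) ℂ :=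
  symWeight β E N • (attach (gibbsProb β (copiesEnergy E m)) ∘ₗ conjBy (symProj d N))
    + measurePrepare (symProj d N)
      (attach (gibbsProb β (copiesEnergy E m)) (gibbs β (copiesEnergy E N)
        - symProj d N * gibbs β (copiesEnergy E N) * symProj d N))

theorem thermalOperation_apply (β : ℝ) (E : Fin d → ℝ) (X : Matrix (Copies d N) (Copies d N) ℂ) :
    thermalOperation d N m β E X = symWeight β E N •
        attach (gibbsProb β (copiesEnergy E m)) (symProj d N * X * symProj d N)
      + (symProj d N * X).trace • attach (gibbsProb β (copiesEnergy E m))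
        (gibbs β (copiesEnergy E N) - symProj d N * gibbs β (copiesEnergy E N) * symProj d N) := by
  simp [thermalOperation, conjBy_apply, measurePrepare_apply, symProj_isHermitian]

theorem isCompletelyPositive_cloningOperation (hd : 0 < d) :
    IsCompletelyPositive (cloningOperation d N m) :=
  ((isCompletelyPositive_conjBy _).comp (isCompletelyPositive_attach zero_le_one)).smul
    (div_pos (symDim_pos hd) (symDim_pos hd)).le

theorem isCompletelyPositive_thermalOperation (hd : 0 < d) (β : ℝ) (E : Fin d → ℝ) :
    IsCompletelyPositive (thermalOperation d N m β E) := by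
  have : Nonempty (Copies d m) := ⟨fun _ => ⟨0, hd⟩⟩
  have hatt : IsCompletelyPositive (attach (N := N) (gibbsProb β (copiesEnergy E m))) :=
    isCompletelyPositive_attach fun i => (gibbsProb_pos _ _ i).le
  exact ((hatt.comp (isCompletelyPositive_conjBy _)).smul (symWeight_pos hd β E N).le).add
    (isCompletelyPositive_measurePrepare symProj_posSemidef
      (hatt.posSemidef (gibbs_sub_symProj_conj_posSemidef hd β E N)))

theorem trace_cloningOperation (hd : 0 < d) (X : Matrix (Copies d N) (Copies d N) ℂ) :
    (cloningOperation d N m X).trace = (symProj d N * X).trace := by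
  have h1 : (symDim d N : ℂ) ≠ 0 := by exact_mod_cast (symDim_pos hd).ne'
  have h2 : (symDim d (N + m) : ℂ) ≠ 0 := by exact_mod_cast (symDim_pos hd).ne'
  rw [cloningOperation_apply, trace_smul, trace_symProj_conj, trace_mul_attach_one,
    discard_symProj hd, Matrix.smul_mul, trace_smul, smul_eq_mul, Complex.real_smul]
  push_cast
  field_simp

theorem trace_thermalOperation (hd : 0 < d) (β : ℝ) (E : Fin d → ℝ)
    (X : Matrix (Copies d N) (Copies d N) ℂ) :
    (thermalOperation d N m β E X).trace = (symProj d N * X).trace := by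
  have : Nonempty (Copies d N) := ⟨fun _ => ⟨0, hd⟩⟩
  have : Nonempty (Copies d m) := ⟨fun _ => ⟨0, hd⟩⟩
  rw [thermalOperation_apply, trace_add, trace_smul, trace_smul, trace_attach, trace_attach,
    sum_gibbsProb, Complex.ofReal_one, mul_one, mul_one, trace_symProj_conj, trace_sub,
    trace_symProj_conj, trace_symProj_mul_gibbs hd, (gibbs_isDensity β _).2, Complex.real_smul,
    smul_eq_mul]
  ring

theorem cloningOperation_gibbs_le (hd : 0 < d) (β : ℝ) (E : Fin d → ℝ) {x : Fin d}
    (hx : ∀ a, gibbsProb β E x ≤ gibbsProb β E a) :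
    ((symDim d N / symDim d (N + m) * (gibbsProb β E x ^ m)⁻¹) • gibbs β (copiesEnergy E (N + m))
      - cloningOperation d N m (gibbs β (copiesEnergy E N))).PosSemidef := by
  have : Nonempty (Fin d) := ⟨⟨0, hd⟩⟩
  set P := symProj d (N + m) with hP
  set Γ := gibbs β (copiesEnergy E (N + m)) with hΓ
  set D := attach (m := m) 1 (gibbs β (copiesEnergy E N)) with hD
  set c := (gibbsProb β E x ^ m)⁻¹ with hc
  have hc0 : 0 ≤ c := (inv_pos.2 (pow_pos (gibbsProb_pos β E x) m)).le
  have h1 := posSemidef_real_smul hc0 (gibbs_sub_symProj_conj_posSemidef hd β E (N + m))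
  have h2 := (attach_one_gibbs_le (N := N) (m := m) hd β E hx).mul_mul_conjTranspose_same P
  rw [symProj_isHermitian] at h2
  have h := posSemidef_real_smul (div_pos (symDim_pos hd) (symDim_pos hd)).le (h1.add h2)
    (c := symDim d N / symDim d (N + m))
  convert h using 1
  rw [cloningOperation_apply, ← hP, ← hΓ, ← hD, Matrix.mul_sub, Matrix.sub_mul, Matrix.mul_smul,
    Matrix.smul_mul, smul_sub c, sub_add_sub_cancel, smul_sub, smul_smul]

theorem thermalOperation_gibbs (hd : 0 < d) (β : ℝ) (E : Fin d → ℝ) :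
    thermalOperation d N m β E (gibbs β (copiesEnergy E N))
      = symWeight β E N • gibbs β (copiesEnergy E (N + m)) := by
  rw [thermalOperation_apply, trace_symProj_mul_gibbs hd, map_sub, attach_gibbs, Complex.coe_smul,
    smul_sub, add_sub_cancel]

theorem trace_copiesState_mul_attach_one (ψ : PureState d) :
    (copiesState (N + m) ψ * attach 1 (copiesState N ψ)).trace = 1 := by
  rw [trace_mul_attach_one, copiesState_eq, discard_tensorPowOp, ψ.sum_star_mul_self, one_pow,
    one_smul, copiesState_eq, trace_tensorPowOp_mul, ψ.sum_star_mul_self]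
  simp

theorem trace_copiesState_mul_cloningOperation (ψ : PureState d) :
    (copiesState (N + m) ψ * cloningOperation d N m (copiesState N ψ)).trace
      = ((symDim d N / symDim d (N + m) : ℝ) : ℂ) := by
  have h1 : copiesState (N + m) ψ * symProj d (N + m) = copiesState (N + m) ψ :=
    tensorPowOp_mul_symProj _
  have h2 : symProj d (N + m) * copiesState (N + m) ψ = copiesState (N + m) ψ :=
    symProj_mul_tensorPowOp _
  rw [cloningOperation_apply, Matrix.mul_smul, trace_smul, Matrix.trace_mul_comm, Matrix.mul_assoc,
    h2, Matrix.trace_mul_comm, ← Matrix.mul_assoc, h1, trace_copiesState_mul_attach_one,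
    Complex.real_smul, mul_one]

/-- The Gibbs state of the added copies dominates `p ^ m` times the identity, if `p` is the smallest
Gibbs probability, and adding the identity has perfect overlap with the perfect clones. -/
theorem le_trace_copiesState_mul_thermalOperation (hd : 0 < d) (β : ℝ) (E : Fin d → ℝ) {x : Fin d}
    (hx : ∀ a, gibbsProb β E x ≤ gibbsProb β E a) (ψ : PureState d) :
    symWeight β E N * gibbsProb β E x ^ m
      ≤ (copiesState (N + m) ψ * thermalOperation d N m β E (copiesState N ψ)).trace.re := by
  have : Nonempty (Fin d) := ⟨⟨0, hd⟩⟩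
  have hO := tensorPowOp_posSemidef (n := N + m) ψ.1
  rw [← copiesState_eq] at hO
  have hp := gibbsProb_pos β E
  set g := gibbsProb β (copiesEnergy E m) with hg
  have hge : ∀ b : Copies d m, gibbsProb β E x ^ m ≤ g b := by
    intro b
    rw [hg, gibbsProb_copiesEnergy]
    simpa using Finset.prod_le_prod (s := (Finset.univ : Finset (Fin m))) (fun k _ => (hp x).le)
      fun k _ => hx (b k)
  -- attaching `g` differs from attaching the constant weight by attaching a nonnegative weight
  have hsplit : attach g (copiesState N ψ) = (gibbsProb β E x ^ m) • attach 1 (copiesState N ψ)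
      + attach (fun b => g b - gibbsProb β E x ^ m) (copiesState N ψ) := by
    ext i j
    simp only [Matrix.add_apply, Matrix.smul_apply, attach_apply, Pi.one_apply]
    split_ifs
    · simp; ring
    · simp
  have h1 := PosSemidef.trace_mul_re_nonneg hO
    ((isCompletelyPositive_attach (N := N) (w := fun b => g b - gibbsProb β E x ^ m)
      fun b => sub_nonneg.2 (hge b)).posSemidef (tensorPowOp_posSemidef ψ.1))
  rw [← copiesState_eq] at h1
  have h2 := PosSemidef.trace_mul_re_nonneg hO
    ((isCompletelyPositive_attach (N := N) (w := g)
      fun b => (gibbsProb_pos β (copiesEnergy E m) b).le).posSemidef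
        (gibbs_sub_symProj_conj_posSemidef hd β E N))
  have hP : (symProj d N * copiesState N ψ).trace = 1 := by
    rw [copiesState_eq, symProj_mul_tensorPowOp, ← copiesState_eq, (copiesState_isDensity ψ).2]
  rw [thermalOperation_apply, symProj_conj_copiesState, hP, one_smul, Matrix.mul_add, trace_add,
    Complex.add_re, ← hg, Matrix.mul_smul, trace_smul, Complex.real_smul, Complex.re_ofReal_mul,
    hsplit, Matrix.mul_add, trace_add, Matrix.mul_smul, trace_smul,
    trace_copiesState_mul_attach_one, Complex.add_re, Complex.real_smul, mul_one,
    Complex.ofReal_re]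
  have hq := symWeight_pos hd β E N
  have := mul_nonneg hq.le h1
  linarith

/-- A completely positive map that preserves the trace on the symmetric subspace and vanishes on
its complement is a quantum operation and acts as some channel on the symmetric subspace. -/
theorem exists_channel_of_trace_eq (hd : 0 < d) {N' : ℕ}
    {Φ : Matrix (Copies d N) (Copies d N) ℂ →ₗ[ℂ] Matrix (Copies d N') (Copies d N') ℂ}
    (hΦ : IsCompletelyPositive Φ) (htr : ∀ X, (Φ X).trace = (symProj d N * X).trace) :
    IsQuantumOperation Φ ∧ ∃ M, IsChannel M ∧
      ∀ X, M (symProj d N * X * symProj d N) = Φ (symProj d N * X * symProj d N) := by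
  refine ⟨⟨hΦ, fun ρ hρ => ?_⟩, Φ + measurePrepare (1 - symProj d N)
    (copiesState N' (basisState ⟨0, hd⟩)), ⟨hΦ.add (isCompletelyPositive_measurePrepare
      one_sub_symProj_posSemidef (tensorPowOp_posSemidef _)), fun X => ?_⟩, fun X => ?_⟩
  · have h := PosSemidef.trace_mul_re_nonneg (one_sub_symProj_posSemidef (d := d) (n := N)) hρ.1
    rw [Matrix.sub_mul, Matrix.one_mul, trace_sub, hρ.2, Complex.sub_re, Complex.one_re] at h
    rw [htr]
    linarith
  · rw [LinearMap.add_apply, trace_add, htr, measurePrepare_apply, trace_smul,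
      (copiesState_isDensity _).2, smul_eq_mul, mul_one, Matrix.sub_mul, Matrix.one_mul, trace_sub]
    ring
  · rw [LinearMap.add_apply, measurePrepare_apply, Matrix.sub_mul, Matrix.one_mul,
      ← Matrix.mul_assoc, ← Matrix.mul_assoc, symProj_mul_self, sub_self, trace_zero, zero_smul,
      add_zero]

end Tradeoff

/-! ### Attaining the trade-off -/

section Optimal

variable {d N m : ℕ}

/-- Mixtures of the thermal operation and the optimal cloner attain the trade-off
`F = 2 ^ c * p ^ m` between accuracy and cost, for every accuracy between those of the two. -/
theorem exists_channel_accuracy_cost (hd : 0 < d) {kT : ℝ} {E : Fin d → ℝ} {x : Fin d}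
    (hx : ∀ a, gibbsProb (1 / kT) E x ≤ gibbsProb (1 / kT) E a) {F : ℝ}
    (hF : F ∈ segment ℝ (symWeight (1 / kT) E N * gibbsProb (1 / kT) E x ^ m)
      (symDim d N / symDim d (N + m))) :
    ∃ M, IsChannel M ∧ (quantumCloning kT E N (N + m)).accuracy M = F ∧
      (2 : ℝ) ^ (quantumCloning kT E N (N + m)).cost M * gibbsProb (1 / kT) E x ^ m = F := by
  have : Nonempty (Fin d) := ⟨x⟩
  have : Nonempty (Copies d (N + m)) := ⟨fun _ => x⟩
  obtain ⟨s, t, hs, ht, hst, rfl⟩ := hF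
  set β := 1 / kT with hβ
  set K := gibbsProb β E x ^ m with hK
  set q := symWeight β E N with hq
  set D := symDim d N / symDim d (N + m) with hD
  have hK0 : 0 < K := pow_pos (gibbsProb_pos β E x) m
  have hq0 : 0 < q := symWeight_pos hd β E N
  have hD0 : 0 < D := div_pos (symDim_pos hd) (symDim_pos hd)
  let Φ := s • thermalOperation d N m β E + t • cloningOperation d N m
  have hΦ : IsCompletelyPositive Φ := ((isCompletelyPositive_thermalOperation hd β E).smul hs).add
    ((isCompletelyPositive_cloningOperation hd).smul ht)
  have htr : ∀ X, (Φ X).trace = (symProj d N * X).trace := by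
    intro X
    rw [LinearMap.add_apply, LinearMap.smul_apply, LinearMap.smul_apply, trace_add, trace_smul,
      trace_smul, trace_thermalOperation hd, trace_cloningOperation hd, ← add_smul, hst, one_smul]
  obtain ⟨hop, M, hM, hagree⟩ := exists_channel_of_trace_eq hd hΦ htr
  have hcost : (2 : ℝ) ^ (quantumCloning kT E N (N + m)).cost M ≤ s * q + t * (D * K⁻¹) := by
    refine rpow_cost_le hd hM hop (fun ρ _ => (hagree ρ).symm) ?_ ?_
    · have hDK : 0 < D * K⁻¹ := by positivity
      rcases hs.eq_or_lt with rfl | hs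
      · rw [zero_add] at hst
        rw [hst]; linarith
      · have := mul_pos hs hq0
        have := mul_nonneg ht hDK.le
        linarith
    · have h := posSemidef_real_smul ht (cloningOperation_gibbs_le (N := N) (m := m) hd β E hx)
      convert h using 1
      rw [LinearMap.add_apply, LinearMap.smul_apply, LinearMap.smul_apply,
        thermalOperation_gibbs hd, ← hβ, ← hq, ← hD, ← hK, add_smul, smul_sub, smul_smul, smul_smul]
      abel
  have hacc : s * (q * K) + t * D ≤ (quantumCloning kT E N (N + m)).accuracy M := by
    refine le_accuracy hd fun ψ => ?_
    rw [agree_copiesState fun ρ _ => hagree ρ, LinearMap.add_apply, LinearMap.smul_apply,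
      LinearMap.smul_apply, Matrix.mul_add, trace_add, Matrix.mul_smul, Matrix.mul_smul,
      trace_smul, trace_smul, trace_copiesState_mul_cloningOperation, Complex.add_re,
      Complex.real_smul, Complex.real_smul, Complex.re_ofReal_mul, Complex.re_ofReal_mul,
      Complex.ofReal_re]
    exact add_le_add (mul_le_mul_of_nonneg_left
      (le_trace_copiesState_mul_thermalOperation hd β E hx ψ) hs) le_rfl
  have hlow := accuracy_le_of_mem_costExponents (kT := kT) hd hM (isLeast_cost hd kT E hM).1 x
  have hup : (2 : ℝ) ^ (quantumCloning kT E N (N + m)).cost M * K ≤ s * (q * K) + t * D := by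
    calc _ ≤ (s * q + t * (D * K⁻¹)) * K := mul_le_mul_of_nonneg_right hcost hK0.le
      _ = s * (q * K) + t * D := by field_simp
  simp only [smul_eq_mul]
  exact ⟨M, hM, le_antisymm (hlow.trans hup) hacc, le_antisymm hup (hacc.trans hlow)⟩

theorem cloningOperation_copiesState (h : N ≤ N + m) (ψ : PureState d) :
    cloningOperation d N m (copiesState N ψ) = (symDim d N / symDim d (N + m))
      • (symProj d (N + m) * tensorId h (copiesState N ψ) * symProj d (N + m)) := by
  rw [cloningOperation_apply, tensorId_eq_attach]

theorem exists_isOptimalCloner (hd : 0 < d) (h : N ≤ N + m) :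
    ∃ M, IsOptimalCloner (d := d) h M := by
  obtain ⟨-, M, hM, hagree⟩ := exists_channel_of_trace_eq hd
    (isCompletelyPositive_cloningOperation hd) (trace_cloningOperation (N := N) (m := m) hd)
  exact ⟨M, hM, fun ψ => by
    rw [agree_copiesState fun ρ _ => hagree ρ, cloningOperation_copiesState h]⟩

theorem IsOptimalCloner.apply_copiesState {h : N ≤ N + m}
    {M : Matrix (Copies d N) (Copies d N) ℂ →ₗ[ℂ] Matrix (Copies d (N + m)) (Copies d (N + m)) ℂ}
    (hM : IsOptimalCloner h M) (ψ : PureState d) :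
    M (copiesState N ψ) = cloningOperation d N m (copiesState N ψ) := by
  rw [hM.2, cloningOperation_copiesState h]

theorem IsOptimalCloner.accuracy_eq (hd : 0 < d) {h : N ≤ N + m} {kT : ℝ} {E : Fin d → ℝ}
    {M : Matrix (Copies d N) (Copies d N) ℂ →ₗ[ℂ] Matrix (Copies d (N + m)) (Copies d (N + m)) ℂ}
    (hM : IsOptimalCloner h M) :
    (quantumCloning kT E N (N + m)).accuracy M = symDim d N / symDim d (N + m) :=
  le_antisymm (accuracy_le_symDim_div hd hM.1) (le_accuracy hd fun ψ => by
    rw [hM.apply_copiesState, trace_copiesState_mul_cloningOperation, Complex.ofReal_re])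

/-- Any optimal cloner acts as `cloningOperation` on the whole symmetric subspace, as the product
states span the operators there; this bounds its cost from above. -/
theorem IsOptimalCloner.rpow_cost_mul (hd : 0 < d) {h : N ≤ N + m} {kT : ℝ} {E : Fin d → ℝ}
    {M : Matrix (Copies d N) (Copies d N) ℂ →ₗ[ℂ] Matrix (Copies d (N + m)) (Copies d (N + m)) ℂ}
    (hM : IsOptimalCloner h M) {x : Fin d}
    (hx : ∀ a, gibbsProb (1 / kT) E x ≤ gibbsProb (1 / kT) E a) :
    (2 : ℝ) ^ (quantumCloning kT E N (N + m)).cost M * gibbsProb (1 / kT) E x ^ m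
      = symDim d N / symDim d (N + m) := by
  have : Nonempty (Fin d) := ⟨x⟩
  have hK0 : 0 < gibbsProb (1 / kT) E x ^ m := pow_pos (gibbsProb_pos _ E x) m
  have hD0 : 0 < symDim d N / symDim d (N + m) := div_pos (symDim_pos hd) (symDim_pos hd)
  have hop := (exists_channel_of_trace_eq hd
    (isCompletelyPositive_cloningOperation hd) (trace_cloningOperation (N := N) (m := m) hd)).1
  refine le_antisymm ?_ ?_
  · have h1 := rpow_cost_le (kT := kT) (E := E) hd hM.1 hop
      (fun ρ _ => eq_on_symProj_conj hd (fun ψ => (hM.apply_copiesState ψ).symm) ρ)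
      (mul_pos hD0 (inv_pos.2 hK0)) (cloningOperation_gibbs_le hd _ E hx)
    calc _ ≤ _ := mul_le_mul_of_nonneg_right h1 hK0.le
      _ = _ := by field_simp
  · rw [← hM.accuracy_eq hd (kT := kT) (E := E)]
    exact accuracy_le_of_mem_costExponents hd hM.1 (isLeast_cost hd kT E hM.1).1 x

/-! ### The time-reversed task -/

/-- Discarding copies in the time-reversed task: the factors `Γ ^ (1/2)` and `Γ ^ (-1/2)` cancel on
the copies that are kept, and each discarded copy contributes `⟨ψ|Γ|ψ⟩`. -/
theorem trace_reverse_discard (hd : 0 < d) (β : ℝ) (E : Fin d → ℝ) (ψ : PureState d) :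
    ((gibbsPow β (copiesEnergy E N) (-(1 / 2)) * copiesState N ψ
        * gibbsPow β (copiesEnergy E N) (-(1 / 2)))
      * discard (gibbsPow β (copiesEnergy E (N + m)) (1 / 2) * copiesState (N + m) ψ
        * gibbsPow β (copiesEnergy E (N + m)) (1 / 2))).trace
      = (((∑ a, gibbsProb β E a * ‖ψ.1 a‖ ^ 2) ^ m : ℝ) : ℂ) := by
  have : Nonempty (Fin d) := ⟨⟨0, hd⟩⟩
  have hp := gibbsProb_pos β E
  have hcancel : ∀ a, ((gibbsProb β E a ^ (-(1 / 2) : ℝ) : ℝ) : ℂ)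
      * ((gibbsProb β E a ^ (1 / 2 : ℝ) : ℝ) : ℂ) = 1 := by
    intro a
    rw [← Complex.ofReal_mul, ← Real.rpow_add (hp a), neg_add_cancel, Real.rpow_zero,
      Complex.ofReal_one]
  have hsq : ∀ a, ((gibbsProb β E a ^ (1 / 2 : ℝ) : ℝ) : ℂ)
      * ((gibbsProb β E a ^ (1 / 2 : ℝ) : ℝ) : ℂ) = (gibbsProb β E a : ℂ) := by
    intro a
    rw [← Complex.ofReal_mul, ← Real.rpow_add (hp a), add_halves, Real.rpow_one]
  rw [copiesState_eq, copiesState_eq, gibbsPow_mul_tensorPowOp_mul hd,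
    gibbsPow_mul_tensorPowOp_mul hd, discard_tensorPowOp, Matrix.mul_smul, trace_smul,
    trace_tensorPowOp_mul]
  simp only [star_mul', Complex.star_def, Complex.conj_ofReal]
  have h1 : ∑ a, ((gibbsProb β E a ^ (-(1 / 2) : ℝ) : ℝ) : ℂ) * (starRingEnd ℂ) (ψ.1 a)
      * (((gibbsProb β E a ^ (1 / 2 : ℝ) : ℝ) : ℂ) * ψ.1 a) = 1 := by
    rw [← ψ.sum_star_mul_self]
    refine Finset.sum_congr rfl fun a _ => ?_
    rw [Complex.star_def]
    linear_combination ((starRingEnd ℂ) (ψ.1 a) * ψ.1 a) * hcancel a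
  have h2 : ∑ a, ((gibbsProb β E a ^ (1 / 2 : ℝ) : ℝ) : ℂ) * (starRingEnd ℂ) (ψ.1 a)
      * (((gibbsProb β E a ^ (-(1 / 2) : ℝ) : ℝ) : ℂ) * ψ.1 a) = 1 := by
    rw [← ψ.sum_star_mul_self]
    refine Finset.sum_congr rfl fun a _ => ?_
    rw [Complex.star_def]
    linear_combination ((starRingEnd ℂ) (ψ.1 a) * ψ.1 a) * hcancel a
  have h3 : ∑ a, ((gibbsProb β E a ^ (1 / 2 : ℝ) : ℝ) : ℂ) * (starRingEnd ℂ) (ψ.1 a)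
      * (((gibbsProb β E a ^ (1 / 2 : ℝ) : ℝ) : ℂ) * ψ.1 a)
      = ((∑ a, gibbsProb β E a * ‖ψ.1 a‖ ^ 2 : ℝ) : ℂ) := by
    rw [Complex.ofReal_sum]
    refine Finset.sum_congr rfl fun a _ => ?_
    have hn : ((‖ψ.1 a‖ ^ 2 : ℝ) : ℂ) = (starRingEnd ℂ) (ψ.1 a) * ψ.1 a := by
      rw [← Complex.normSq_eq_norm_sq, Complex.normSq_eq_conj_mul_self]
    rw [Complex.ofReal_mul, hn]
    linear_combination ((starRingEnd ℂ) (ψ.1 a) * ψ.1 a) * hsq a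
  rw [h1, h2, h3]
  simp

theorem trace_reverse_basisState_le (β : ℝ) (E : Fin d → ℝ) (x : Fin d)
    {R : Matrix (Copies d (N + m)) (Copies d (N + m)) ℂ →ₗ[ℂ] Matrix (Copies d N) (Copies d N) ℂ}
    (hR : IsChannel R) :
    ((gibbsPow β (copiesEnergy E N) (-(1 / 2)) * copiesState N (basisState x)
        * gibbsPow β (copiesEnergy E N) (-(1 / 2)))
      * R (gibbsPow β (copiesEnergy E (N + m)) (1 / 2) * copiesState (N + m) (basisState x)
        * gibbsPow β (copiesEnergy E (N + m)) (1 / 2))).trace.re ≤ gibbsProb β E x ^ m := by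
  have : Nonempty (Fin d) := ⟨x⟩
  have hp := gibbsProb_pos β E x
  have hsq : ∀ (n : ℕ), ((gibbsProb β E x ^ n) ^ (1 / 2 : ℝ)) ^ 2 = gibbsProb β E x ^ n := by
    intro n
    rw [← Real.sqrt_eq_rpow, Real.sq_sqrt (pow_pos hp n).le]
  have hinv : ((gibbsProb β E x ^ N) ^ (-(1 / 2) : ℝ)) ^ 2 = (gibbsProb β E x ^ N)⁻¹ := by
    rw [Real.rpow_neg (pow_pos hp N).le, inv_pow, hsq]
  have hdens := copiesState_isDensity (n := N + m) (basisState x)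
  rw [copiesState_basisState, copiesState_basisState, gibbsPow_mul_single_mul,
    gibbsPow_mul_single_mul,
    gibbsProb_copiesEnergy, gibbsProb_copiesEnergy, ← copiesState_basisState,
    ← copiesState_basisState]
  simp only [Finset.prod_const, Finset.card_univ, Fintype.card_fin, hsq, hinv]
  rw [map_smul, Matrix.smul_mul, Matrix.mul_smul, trace_smul, trace_smul,
    trace_copiesState_basisState_mul, smul_eq_mul, smul_eq_mul, Complex.re_ofReal_mul,
    Complex.re_ofReal_mul]
  have h1 := PosSemidef.apply_self_re_le_trace (hR.1.posSemidef hdens.1) fun _ => x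
  rw [hR.2, hdens.2, Complex.one_re] at h1
  have hpN := pow_pos hp N
  calc _ ≤ (gibbsProb β E x ^ N)⁻¹ * (gibbsProb β E x ^ (N + m) * 1) := by gcongr
    _ = gibbsProb β E x ^ m := by rw [pow_add]; field_simp

/-- The time-reversed task of cloning any family of pure states that contains the eigenstate `x` of
the highest energy: discarding copies is optimal, and the eigenstate `x` is the worst case. -/
theorem isGreatest_revAccuracies (hd : 0 < d) {X : Type} (s : X → PureState d) {x₀ : X} {x : Fin d}
    (hs : s x₀ = basisState x) (β : ℝ) (E : Fin d → ℝ)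
    (hx : ∀ a, gibbsProb β E x ≤ gibbsProb β E a) (P : Matrix (Copies d N) (Copies d N) ℂ) :
    IsGreatest (Task.revAccuracies (X := X) (A := Copies d N) (B := Copies d (N + m))
      { β := β, energyIn := copiesEnergy E N, energyOut := copiesEnergy E (N + m), proj := P,
        state := fun y => copiesState N (s y), obs := fun y => copiesState (N + m) (s y) })
      (gibbsProb β E x ^ m) := by
  have : Nonempty (Fin d) := ⟨x⟩
  have : Nonempty X := ⟨x₀⟩
  set t : Task X (Copies d N) (Copies d (N + m)) :=
    { β := β, energyIn := copiesEnergy E N, energyOut := copiesEnergy E (N + m), proj := P,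
      state := fun y => copiesState N (s y), obs := fun y => copiesState (N + m) (s y) } with ht
  have hle : ∀ R, IsChannel R → t.revAccuracy R ≤ gibbsProb β E x ^ m := by
    intro R hR
    refine (ciInf_le ⟨0, ?_⟩ x₀).trans ?_
    · rintro _ ⟨y, rfl⟩
      have hpos : ∀ (n : ℕ) (r : ℝ), (gibbsPow β (copiesEnergy E n) r * copiesState n (s y)
          * gibbsPow β (copiesEnergy E n) r).PosSemidef := by
        intro n r
        rw [copiesState_eq, gibbsPow_mul_tensorPowOp_mul hd]
        exact tensorPowOp_posSemidef _
      exact PosSemidef.trace_mul_re_nonneg (hpos N _) (hR.1.posSemidef (hpos (N + m) _))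
    · simp only [ht, hs]
      exact trace_reverse_basisState_le β E x hR
  refine ⟨⟨discard, isChannel_discard, le_antisymm (le_ciInf fun y => ?_)
    (hle _ isChannel_discard)⟩, ?_⟩
  · have hnorm : ∑ a, ‖(s y).1 a‖ ^ 2 = 1 := by
      have := EuclideanSpace.norm_sq_eq (s y).1
      rw [(s y).2, one_pow] at this
      exact this.symm
    simp only [ht]
    rw [trace_reverse_discard hd, Complex.ofReal_re]
    refine pow_le_pow_left₀ (gibbsProb_pos β E x).le ?_ m
    calc gibbsProb β E x = ∑ a, gibbsProb β E x * ‖(s y).1 a‖ ^ 2 := by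
          rw [← Finset.mul_sum, hnorm, mul_one]
      _ ≤ _ := Finset.sum_le_sum fun a _ => mul_le_mul_of_nonneg_right (hx a) (by positivity)
  · rintro _ ⟨R, hR, rfl⟩
    exact hle R hR

/-- The smallest Gibbs probability belongs to the highest energy. -/
theorem exists_min_gibbsProb (hd : 0 < d) {kT : ℝ} (hkT : 0 < kT) (E : Fin d → ℝ) (m : ℕ) :
    ∃ x, (∀ a, gibbsProb (1 / kT) E x ≤ gibbsProb (1 / kT) E a) ∧
      m * maxFreeEnergyGap kT E / (kT * Real.log 2)
        = -Real.logb 2 (gibbsProb (1 / kT) E x ^ m) := by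
  have : Nonempty (Fin d) := ⟨⟨0, hd⟩⟩
  have hZ : 0 < partitionFunction (1 / kT) E :=
    Finset.sum_pos (fun _ _ => Real.exp_pos _) Finset.univ_nonempty
  obtain ⟨x, hx⟩ := Finite.exists_max E
  refine ⟨x, fun a => ?_, ?_⟩
  · refine div_le_div_of_nonneg_right (Real.exp_le_exp.2 ?_) hZ.le
    rw [neg_mul, neg_mul, neg_le_neg_iff]
    exact mul_le_mul_of_nonneg_left (hx a) (by positivity)
  · have hsup : ⨆ i, E i = E x :=
      le_antisymm (ciSup_le hx) (le_ciSup (Set.finite_range E).bddAbove x)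
    have hlog : Real.log (gibbsProb (1 / kT) E x)
        = -(E x / kT) - Real.log (partitionFunction (1 / kT) E) := by
      rw [gibbsProb, Real.log_div (Real.exp_pos _).ne' hZ.ne', Real.log_exp]
      ring
    have hlog2 : Real.log 2 ≠ 0 := (Real.log_pos (by norm_num)).ne'
    rw [maxFreeEnergyGap, gibbsFreeEnergy, hsup, Real.logb, Real.log_pow, hlog]
    field_simp
    ring

end Optimal

end ThermoCloning

/-! ### Cost and accuracy of universal quantum cloning -/

open ThermoCloning
theorem mainTheorem8 (d N N' : ℕ) (hd : 0 < d) (hN : N ≤ N') (E : Fin d → ℝ)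
    (k T : ℝ) (hk : 0 < k) (hT : 0 < T) :
    -- the optimal cloner exists; it is optimal, with fidelity `d_N / d_{N'}`
    (∃ M, IsOptimalCloner (d := d) hN M) ∧
    (∀ M, IsOptimalCloner (d := d) hN M →
      (quantumCloning (k * T) E N N').accuracy M = symDim d N / symDim d N') ∧
    IsGreatest (quantumCloning (k * T) E N N').accuracies (symDim d N / symDim d N') ∧
    -- the minimum that defines the nonequilibrium cost of a channel is attained
    (∀ M, IsChannel M →
      IsLeast (costExponents (1 / (k * T)) (copiesEnergy E N) (copiesEnergy E N') (symProj d N) M)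
        ((quantumCloning (k * T) E N N').cost M)) ∧
    -- the nonequilibrium cost of the optimal cloner
    (∀ M, IsOptimalCloner (d := d) hN M →
      (quantumCloning (k * T) E N N').cost M
          = ((N' : ℝ) - N) * maxFreeEnergyGap (k * T) E / (k * T * Real.log 2)
            + Real.logb 2 (symDim d N / symDim d N')) ∧
    -- the reverse entropies (the maxima that define them are attained)
    IsGreatest (quantumCloning (k * T) E N N').revAccuracies
      (quantumCloning (k * T) E N N').maxRevAccuracy ∧
    IsGreatest (classicalCloning (k * T) E N N').revAccuracies
      (classicalCloning (k * T) E N N').maxRevAccuracy ∧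
    (quantumCloning (k * T) E N N').reverseEntropy
      = (classicalCloning (k * T) E N N').reverseEntropy ∧
    (classicalCloning (k * T) E N N').reverseEntropy
      = ((N' : ℝ) - N) * maxFreeEnergyGap (k * T) E / (k * T * Real.log 2) ∧
    -- the minimum cost and `F_min`
    IsLeast (quantumCloning (k * T) E N N').costs (quantumCloning (k * T) E N N').minCost ∧
    IsGreatest (quantumCloning (k * T) E N N').accuraciesAtMinCost
      (quantumCloning (k * T) E N N').minAccuracy ∧
    (quantumCloning (k * T) E N N').minAccuracy
      = (2 : ℝ) ^ ((quantumCloning (k * T) E N N').minCost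
          - (quantumCloning (k * T) E N N').reverseEntropy) ∧
    -- the optimal cost of cloning on the whole interval `[F_min, F_max]`
    (∀ F ∈ Set.Icc (quantumCloning (k * T) E N N').minAccuracy (symDim d N / symDim d N'),
      IsLeast ((quantumCloning (k * T) E N N').costsOfAccuracy F)
        ((quantumCloning (k * T) E N N').costOfAccuracy F) ∧
      (quantumCloning (k * T) E N N').costOfAccuracy F
        = (quantumCloning (k * T) E N N').reverseEntropy + Real.logb 2 F ∧
      (quantumCloning (k * T) E N N').costOfAccuracy F
        = ((N' : ℝ) - N) * maxFreeEnergyGap (k * T) E / (k * T * Real.log 2)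
          + Real.logb 2 F) := by
  obtain ⟨m, rfl⟩ := Nat.exists_eq_add_of_le hN
  have hkT : 0 < k * T := mul_pos hk hT
  have : Nonempty (Fin d) := ⟨⟨0, hd⟩⟩
  obtain ⟨x, hx, hκ⟩ := exists_min_gibbsProb hd hkT E m
  have hcast : ((N + m : ℕ) : ℝ) - N = m := by push_cast; ring
  rw [hcast, hκ]
  have hQ := isGreatest_revAccuracies (N := N) (m := m) hd (fun ψ => ψ) (x₀ := basisState x) rfl
    (1 / (k * T)) E hx (symProj d N)
  have hC := isGreatest_revAccuracies (N := N) (m := m) hd basisState (x₀ := x) rfl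
    (1 / (k * T)) E hx (classicalCloning (k * T) E N (N + m)).proj
  have hQmax : (quantumCloning (k * T) E N (N + m)).maxRevAccuracy
      = gibbsProb (1 / (k * T)) E x ^ m := hQ.csSup_eq
  have hCmax : (classicalCloning (k * T) E N (N + m)).maxRevAccuracy
      = gibbsProb (1 / (k * T)) E x ^ m := hC.csSup_eq
  have hQκ : (quantumCloning (k * T) E N (N + m)).reverseEntropy
      = -Real.logb 2 (gibbsProb (1 / (k * T)) E x ^ m) := by rw [Task.reverseEntropy, hQmax]
  have hCκ : (classicalCloning (k * T) E N (N + m)).reverseEntropy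
      = -Real.logb 2 (gibbsProb (1 / (k * T)) E x ^ m) := by rw [Task.reverseEntropy, hCmax]
  rw [hQκ, hCκ, hQmax, hCmax]
  set K := gibbsProb (1 / (k * T)) E x ^ m with hK
  set q := symWeight (1 / (k * T)) E N with hq
  set D := symDim d N / symDim d (N + m) with hD
  have hK0 : 0 < K := pow_pos (gibbsProb_pos _ E x) m
  have hq0 : 0 < q := symWeight_pos hd _ E N
  have hlog : ∀ {c F : ℝ}, (2 : ℝ) ^ c * K = F → c = -Real.logb 2 K + Real.logb 2 F := by
    rintro c F rfl
    rw [Real.logb_mul (Real.rpow_pos_of_pos (by norm_num) c).ne' hK0.ne',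
      Real.logb_rpow (by norm_num) (by norm_num)]
    ring
  have htrade : ∀ M, IsChannel M → (quantumCloning (k * T) E N (N + m)).accuracy M
      ≤ (2 : ℝ) ^ (quantumCloning (k * T) E N (N + m)).cost M * K := fun M hM =>
    accuracy_le_of_mem_costExponents hd hM (isLeast_cost hd _ E hM).1 x
  -- the channel of smallest cost and largest accuracy
  obtain ⟨M₀, hM₀, hacc₀, hcost₀⟩ := exists_channel_accuracy_cost (N := N) (m := m) hd hx
    (left_mem_segment ℝ _ _)
  have hcost₀' : (2 : ℝ) ^ (quantumCloning (k * T) E N (N + m)).cost M₀ = q :=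
    mul_right_cancel₀ hK0.ne' hcost₀
  have hmin : IsLeast (quantumCloning (k * T) E N (N + m)).costs
      ((quantumCloning (k * T) E N (N + m)).cost M₀) := by
    refine ⟨⟨M₀, hM₀, rfl⟩, ?_⟩
    rintro _ ⟨M, hM, rfl⟩
    have := symWeight_le_of_mem_costExponents hd hM (isLeast_cost hd (k * T) E hM).1
    rw [← hq, ← hcost₀'] at this
    exact (Real.rpow_le_rpow_left_iff (by norm_num)).1 this
  have hmin' : (quantumCloning (k * T) E N (N + m)).minCost
      = (quantumCloning (k * T) E N (N + m)).cost M₀ := hmin.csInf_eq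
  have hgr : IsGreatest (quantumCloning (k * T) E N (N + m)).accuraciesAtMinCost (q * K) := by
    refine ⟨⟨M₀, hM₀, hmin'.ge, hacc₀.symm⟩, ?_⟩
    rintro _ ⟨M, hM, hle, rfl⟩
    refine (htrade M hM).trans (mul_le_mul_of_nonneg_right ?_ hK0.le)
    rw [← hcost₀']
    exact Real.rpow_le_rpow_of_exponent_le (by norm_num) (hle.trans hmin'.le)
  have hgr' : (quantumCloning (k * T) E N (N + m)).minAccuracy = q * K := hgr.csSup_eq
  obtain ⟨M₁, hM₁⟩ := exists_isOptimalCloner hd hN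
  refine ⟨⟨M₁, hM₁⟩, fun M hM => hM.accuracy_eq hd,
    ⟨⟨M₁, hM₁.1, (hM₁.accuracy_eq hd).symm⟩, ?_⟩, fun M hM => isLeast_cost hd _ E hM,
    fun M hM => hlog (hM.rpow_cost_mul hd hx), hQ, hC, rfl, rfl, ?_, ?_, ?_, fun F hF => ?_⟩
  · rintro _ ⟨M, hM, rfl⟩
    exact accuracy_le_symDim_div hd hM
  · rwa [hmin']
  · rwa [hgr']
  · rw [hgr', hmin', sub_neg_eq_add, Real.rpow_add (by norm_num), hcost₀',
      Real.rpow_logb (by norm_num) (by norm_num) hK0]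
  · rw [hgr'] at hF
    have hF0 : 0 < F := (mul_pos hq0 hK0).trans_le hF.1
    obtain ⟨M, hM, hacc, hcost⟩ := exists_channel_accuracy_cost (N := N) (m := m) hd hx
      (F := F) (by rw [segment_eq_Icc (hF.1.trans hF.2)]; exact hF)
    have hleast : IsLeast ((quantumCloning (k * T) E N (N + m)).costsOfAccuracy F)
        (-Real.logb 2 K + Real.logb 2 F) := by
      refine ⟨⟨M, hM, hacc.ge, (hlog hcost).symm⟩, ?_⟩
      rintro _ ⟨M', hM', hF', rfl⟩
      have h1 := hF'.trans (htrade M' hM')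
      rw [hlog (c := (quantumCloning (k * T) E N (N + m)).cost M') rfl]
      exact add_le_add le_rfl (Real.logb_le_logb_of_le (by norm_num) hF0 h1)
    have heq : (quantumCloning (k * T) E N (N + m)).costOfAccuracy F
        = -Real.logb 2 K + Real.logb 2 F := hleast.csInf_eq
    rw [heq]
    exact ⟨hleast, rfl, rfl⟩
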